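/- Let $\mathbb K$ be $\mathbb R$ or $\mathbb C$. For a (not necessarily unital) Banach algebra $A$ over $\mathbb K$ and $n\ge 0$ let $C_n(A)=A^{\hat\otimes (n+1)}$ be the $(n+1)$-fold projective tensor power, and let $d_n,\,dr_n: C_{n+1}(A)\to C_n(A)$ be the continuous linear operators given by $$dr_n(a_0\otimes\cdots\otimes a_{n+1})=\sum_{i=0}^{n}(-1)^i\,a_0\otimes\cdots\otimes a_ia_{i+1}\otimes\cdots\otimes a_{n+1},$$ $$d_n(a_0\otimes\cdots\otimes a_{n+1})=dr_n(a_0\otimes\cdots\otimes a_{n+1})+(-1)^{n+1}a_{n+1}a_0\otimes a_1\otimes\cdots\otimes a_n .$$ The Banach simplicial homology groups $\mathcal H_n(A)$ and the Banach bar homology groups $\mathcal{HR}_n(A)$ are the homology groups (cycles modulo boundaries, as vector spaces) of the complexes $(C_n(A),d_n)_{n\ge 0}$ and $(C_n(A),dr_n)_{n\ge 0}$ respectively; the Banach simplicial cohomology groups $\mathcal H^n(A)$ and the Banach bar cohomology groups $\mathcal{HR}^n(A)$ are the cohomology groups of the dual complexes $(C_n(A)^*,d_n^*)$ and $(C_n(A)^*,dr_n^*)$.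 Let $0\to B\xrightarrow{\,i\,}A\xrightarrow{\,j\,}D\to 0$ be a weakly admissible extension of Banach algebras, i.e. a short exact sequence of Banach algebras and continuous homomorphisms such that the dual sequence $0\to D^*\xrightarrow{j^*}A^*\xrightarrow{i^*}B^*\to 0$ of Banach spaces is exact and $i^*$ has a continuous linear right inverse. Then: (I) there exists an associated long exact sequence of Banach simplicial homology groups $$\cdots\to\mathcal H_n(B)\to\mathcal H_n(A)\to\mathcal H_n(D)\xrightarrow{\partial}\mathcal H_{n-1}(B)\to\cdots\to\mathcal H_0(D)\to 0$$ if and only if there exists an associated long exact sequence of Banach simplicial cohomology groups $$0\to\mathcal H^0(D)\to\cdots\to\mathcal H^{n-1}(B)\xrightarrow{\partial}\mathcal H^n(D)\to\mathcal H^n(A)\to\mathcal H^n(B)\to\cdots;$$ (II) there exists an associated long exact sequence of Banach bar homology groups $$\cdots\to\mathcal{HR}_n(B)\to\mathcal{HR}_n(A)\to\mathcal{HR}_n(D)\xrightarrow{\partial}\mathcal{HR}_{n-1}(B)\to\cdots\to\mathcal{HR}_0(D)\to 0$$ if and only if there exists an associated long exact sequence of Banach bar cohomology groups $$0\to\mathcal{HR}^0(D)\to\cdots\to\mathcal{HR}^{n-1}(B)\xrightarrow{\partial}\mathcal{HR}^n(D)\to\mathcal{HR}^n(A)\to\mathcal{HR}^n(B)\to\cdots.$$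 Here "associated" means that the maps other than $\partial$ are those induced by $i$ and $j$, and that $\partial$ is the linear connecting map given by the usual zigzag. In homology (with $d$ the differential of the complex in question): $\partial x=y$ if and only if there are a cycle $z$ representing $x$, a chain $a$ of $A$ with $j^{\hat\otimes}(a)=z$ and a cycle $b$ of $B$ representing $y$ such that $d a=i^{\hat\otimes}(b)$. In cohomology: $\partial y=x$ if and only if there are a cocycle $f$ of $B$ representing $y$, a cochain $g$ of $A$ with $(i^{\hat\otimes})^*g=f$ and a cocycle $h$ of $D$ representing $x$ such that $d^*g=(j^{\hat\otimes})^*h$. -/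

import Mathlib

open scoped TensorProduct

namespace BanachHomology

/-! ### Admissible and weakly admissible short exact sequences of Banach spaces -/

section Admissible

variable {𝕜 : Type*} [RCLike 𝕜]
variable {Y : Type*} [NormedAddCommGroup Y] [NormedSpace 𝕜 Y]
variable {Z : Type*} [NormedAddCommGroup Z] [NormedSpace 𝕜 Z]
variable {W : Type*} [NormedAddCommGroup W] [NormedSpace 𝕜 W]

/-- The dual operator `T^* : Z^* → Y^*`, `f ↦ f ∘ T`, of a continuous linear operator
`T : Y → Z`. -/
noncomputable def dualOp (T : Y →L[𝕜] Z) : StrongDual 𝕜 Z →L[𝕜] StrongDual 𝕜 Y :=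
  ContinuousLinearMap.precomp 𝕜 T

theorem dualOp_apply (T : Y →L[𝕜] Z) (f : StrongDual 𝕜 Z) (y : Y) :
    dualOp T f y = f (T y) := rfl

/-- `0 → Y → Z → W → 0` is a short exact sequence of continuous linear operators. -/
structure IsShortExact (i : Y →L[𝕜] Z) (j : Z →L[𝕜] W) : Prop where
  injective : Function.Injective i
  exact : Function.Exact i j
  surjective : Function.Surjective j

/-- A short exact sequence is admissible if the surjection has a continuous linear right
inverse. -/
structure IsAdmissible (i : Y →L[𝕜] Z) (j : Z →L[𝕜] W) : Prop where
  isShortExact : IsShortExact i j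
  exists_rightInverse : ∃ α : W →L[𝕜] Z, j ∘L α = ContinuousLinearMap.id 𝕜 W

/-- A short exact sequence `0 → Y → Z → W → 0` is weakly admissible if the dual sequence
`0 → W^* → Z^* → Y^* → 0` is admissible. -/
structure IsWeaklyAdmissible (i : Y →L[𝕜] Z) (j : Z →L[𝕜] W) : Prop where
  isShortExact : IsShortExact i j
  isAdmissible_dual : IsAdmissible (dualOp j) (dualOp i)

end Admissible

/-! ### Homology of chain complexes -/

section Homology

variable {𝕜 : Type*} [RCLike 𝕜]
variable {K : ℕ → Type*} [∀ n, NormedAddCommGroup (K n)] [∀ n, NormedSpace 𝕜 (K n)]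
variable {L : ℕ → Type*} [∀ n, NormedAddCommGroup (L n)] [∀ n, NormedSpace 𝕜 (L n)]
variable {M : ℕ → Type*} [∀ n, NormedAddCommGroup (M n)] [∀ n, NormedSpace 𝕜 (M n)]

/-- The cycles of `0 ← K 0 ← K 1 ← ⋯`: everything in degree `0`, and the kernel of
`d n : K (n + 1) → K n` in degree `n + 1`. -/
def cycles (d : ∀ n, K (n + 1) →L[𝕜] K n) : ∀ n, Submodule 𝕜 (K n)
  | 0 => ⊤
  | n + 1 => LinearMap.ker (d n).toLinearMap

/-- The boundaries in degree `n`: the (not necessarily closed) image of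
`d n : K (n + 1) → K n`. -/
def boundaries (d : ∀ n, K (n + 1) →L[𝕜] K n) (n : ℕ) : Submodule 𝕜 (K n) :=
  LinearMap.range (d n).toLinearMap

/-- The homology in degree `n`: cycles modulo boundaries. -/
abbrev Homology (d : ∀ n, K (n + 1) →L[𝕜] K n) (n : ℕ) :=
  cycles d n ⧸ (boundaries d n).submoduleOf (cycles d n)

/-- The homology class of a cycle. -/
def homologyClass (d : ∀ n, K (n + 1) →L[𝕜] K n) (n : ℕ) : cycles d n →ₗ[𝕜] Homology d n :=
  ((boundaries d n).submoduleOf (cycles d n)).mkQ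

/-- A continuous morphism of chain complexes. -/
structure ChainMap (d : ∀ n, K (n + 1) →L[𝕜] K n) (d' : ∀ n, L (n + 1) →L[𝕜] L n) where
  f : ∀ n, K n →L[𝕜] L n
  comm : ∀ n x, f n (d n x) = d' n (f (n + 1) x)

variable {dK : ∀ n, K (n + 1) →L[𝕜] K n} {dL : ∀ n, L (n + 1) →L[𝕜] L n}
  {dM : ∀ n, M (n + 1) →L[𝕜] M n}

theorem ChainMap.mem_cycles (φ : ChainMap dK dL) :
    ∀ (n : ℕ) (x : K n), x ∈ cycles dK n → φ.f n x ∈ cycles dL n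
  | 0, _, _ => Submodule.mem_top
  | n + 1, x, hx => by
    have hx' : dK n x = 0 := hx
    change dL n (φ.f (n + 1) x) = 0
    rw [← φ.comm, hx', map_zero]

/-- The map induced by a chain map on cycles. -/
def ChainMap.cyclesMap (φ : ChainMap dK dL) (n : ℕ) : cycles dK n →ₗ[𝕜] cycles dL n :=
  (φ.f n).toLinearMap.restrict (φ.mem_cycles n)

theorem ChainMap.cyclesMap_le (φ : ChainMap dK dL) (n : ℕ) :
    (boundaries dK n).submoduleOf (cycles dK n) ≤
      ((boundaries dL n).submoduleOf (cycles dL n)).comap (φ.cyclesMap n) := by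
  rintro ⟨_, _⟩ ⟨w, rfl⟩
  exact ⟨φ.f (n + 1) w, (φ.comm n w).symm⟩

/-- The map induced by a chain map on homology, `[x] ↦ [φ x]`. -/
def ChainMap.homologyMap (φ : ChainMap dK dL) (n : ℕ) : Homology dK n →ₗ[𝕜] Homology dL n :=
  Submodule.mapQ _ _ (φ.cyclesMap n) (φ.cyclesMap_le n)

theorem ChainMap.homologyMap_class (φ : ChainMap dK dL) (n : ℕ) (z : cycles dK n) :
    φ.homologyMap n (homologyClass dK n z) = homologyClass dL n (φ.cyclesMap n z) := rfl

/-- `∂ : H_{n+1}(M) → H_n(K)` is the connecting homomorphism attached to chain maps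
`φ : K → L` and `ψ : L → M`, i.e. it is given by the usual zigzag `φ⁻¹ ∘ d ∘ ψ⁻¹`: one has
`∂ x = y` exactly when there are a cycle `z` representing `x`, a chain `a` of `L` lifting `z`,
and a cycle `b` of `K` representing `y` such that `d a = φ b`. -/
def IsConnecting (φ : ChainMap dK dL) (ψ : ChainMap dL dM) (n : ℕ)
    (del : Homology dM (n + 1) →ₗ[𝕜] Homology dK n) : Prop :=
  ∀ x y, del x = y ↔
    ∃ (a : L (n + 1)) (z : cycles dM (n + 1)) (b : cycles dK n),
      ψ.f (n + 1) a = z ∧ dL n a = φ.f n b ∧ homologyClass dM (n + 1) z = x ∧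
        homologyClass dK n b = y

/-- There is an associated long exact sequence
`⋯ → H_n(K) → H_n(L) → H_n(M) → H_{n-1}(K) → ⋯ → H_0(M) → 0`, whose maps are the maps induced by
`φ` and `ψ` and the connecting homomorphisms. -/
def HasLongExactHomology (φ : ChainMap dK dL) (ψ : ChainMap dL dM) : Prop :=
  ∃ del : ∀ n, Homology dM (n + 1) →ₗ[𝕜] Homology dK n,
    (∀ n, IsConnecting φ ψ n (del n)) ∧
    (∀ n, Function.Exact (φ.homologyMap n) (ψ.homologyMap n)) ∧
    (∀ n, Function.Exact (ψ.homologyMap (n + 1)) (del n)) ∧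
    (∀ n, Function.Exact (del n) (φ.homologyMap n)) ∧
    Function.Surjective (ψ.homologyMap 0)

end Homology

/-! ### Cohomology of cochain complexes -/

section Cohomology

variable {𝕜 : Type*} [RCLike 𝕜]
variable {P : ℕ → Type*} [∀ n, NormedAddCommGroup (P n)] [∀ n, NormedSpace 𝕜 (P n)]
variable {Q : ℕ → Type*} [∀ n, NormedAddCommGroup (Q n)] [∀ n, NormedSpace 𝕜 (Q n)]
variable {R : ℕ → Type*} [∀ n, NormedAddCommGroup (R n)] [∀ n, NormedSpace 𝕜 (R n)]

/-- The cocycles of `0 → P 0 → P 1 → ⋯` in degree `n`. -/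
def cocycles (δ : ∀ n, P n →L[𝕜] P (n + 1)) (n : ℕ) : Submodule 𝕜 (P n) :=
  LinearMap.ker (δ n).toLinearMap

/-- The coboundaries: zero in degree `0`, and the (not necessarily closed) image of
`δ n : P n → P (n + 1)` in degree `n + 1`. -/
def coboundaries (δ : ∀ n, P n →L[𝕜] P (n + 1)) : ∀ n, Submodule 𝕜 (P n)
  | 0 => ⊥
  | n + 1 => LinearMap.range (δ n).toLinearMap

/-- The cohomology in degree `n`: cocycles modulo coboundaries. -/
abbrev Cohomology (δ : ∀ n, P n →L[𝕜] P (n + 1)) (n : ℕ) :=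
  cocycles δ n ⧸ (coboundaries δ n).submoduleOf (cocycles δ n)

/-- The cohomology class of a cocycle. -/
def cohomologyClass (δ : ∀ n, P n →L[𝕜] P (n + 1)) (n : ℕ) :
    cocycles δ n →ₗ[𝕜] Cohomology δ n :=
  ((coboundaries δ n).submoduleOf (cocycles δ n)).mkQ

/-- A continuous morphism of cochain complexes. -/
structure CochainMap (δ : ∀ n, P n →L[𝕜] P (n + 1)) (δ' : ∀ n, Q n →L[𝕜] Q (n + 1)) where
  f : ∀ n, P n →L[𝕜] Q n
  comm : ∀ n x, f (n + 1) (δ n x) = δ' n (f n x)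

variable {δP : ∀ n, P n →L[𝕜] P (n + 1)} {δQ : ∀ n, Q n →L[𝕜] Q (n + 1)}
  {δR : ∀ n, R n →L[𝕜] R (n + 1)}

theorem CochainMap.mem_cocycles (φ : CochainMap δP δQ) (n : ℕ) (x : P n)
    (hx : x ∈ cocycles δP n) : φ.f n x ∈ cocycles δQ n := by
  have hx' : δP n x = 0 := hx
  change δQ n (φ.f n x) = 0
  rw [← φ.comm, hx', map_zero]

/-- The map induced by a cochain map on cocycles. -/
def CochainMap.cocyclesMap (φ : CochainMap δP δQ) (n : ℕ) :
    cocycles δP n →ₗ[𝕜] cocycles δQ n :=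
  (φ.f n).toLinearMap.restrict (φ.mem_cocycles n)

theorem CochainMap.cocyclesMap_le (φ : CochainMap δP δQ) : ∀ n : ℕ,
    (coboundaries δP n).submoduleOf (cocycles δP n) ≤
      ((coboundaries δQ n).submoduleOf (cocycles δQ n)).comap (φ.cocyclesMap n)
  | 0 => by
    rintro ⟨x, hx⟩ h
    have h0 : x = 0 := h
    subst h0
    change φ.f 0 0 = 0
    exact map_zero _
  | n + 1 => by
    rintro ⟨_, _⟩ ⟨w, rfl⟩
    exact ⟨φ.f n w, (φ.comm n w).symm⟩

/-- The map induced by a cochain map on cohomology, `[x] ↦ [φ x]`. -/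
def CochainMap.cohomologyMap (φ : CochainMap δP δQ) (n : ℕ) :
    Cohomology δP n →ₗ[𝕜] Cohomology δQ n :=
  Submodule.mapQ _ _ (φ.cocyclesMap n) (φ.cocyclesMap_le n)

theorem CochainMap.cohomologyMap_class (φ : CochainMap δP δQ) (n : ℕ) (z : cocycles δP n) :
    φ.cohomologyMap n (cohomologyClass δP n z) = cohomologyClass δQ n (φ.cocyclesMap n z) := rfl

/-- `del : H^n(R) → H^{n+1}(P)` is the connecting homomorphism attached to cochain maps
`φ : P → Q` and `ψ : Q → R`, i.e. it is given by the usual zigzag `φ⁻¹ ∘ δ ∘ ψ⁻¹`: one has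
`del y = x` exactly when there are a cocycle `r` representing `y`, a cochain `q` of `Q` lifting
`r`, and a cocycle `p` of `P` representing `x` such that `δ q = φ p`. -/
def IsCoconnecting (φ : CochainMap δP δQ) (ψ : CochainMap δQ δR) (n : ℕ)
    (del : Cohomology δR n →ₗ[𝕜] Cohomology δP (n + 1)) : Prop :=
  ∀ y x, del y = x ↔
    ∃ (q : Q n) (r : cocycles δR n) (p : cocycles δP (n + 1)),
      ψ.f n q = r ∧ δQ n q = φ.f (n + 1) p ∧ cohomologyClass δR n r = y ∧
        cohomologyClass δP (n + 1) p = x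

/-- There is an associated long exact sequence
`0 → H^0(P) → ⋯ → H^{n-1}(R) → H^n(P) → H^n(Q) → H^n(R) → ⋯`, whose maps are the maps induced by
`φ` and `ψ` and the connecting homomorphisms. -/
def HasLongExactCohomology (φ : CochainMap δP δQ) (ψ : CochainMap δQ δR) : Prop :=
  ∃ del : ∀ n, Cohomology δR n →ₗ[𝕜] Cohomology δP (n + 1),
    (∀ n, IsCoconnecting φ ψ n (del n)) ∧
    Function.Injective (φ.cohomologyMap 0) ∧
    (∀ n, Function.Exact (φ.cohomologyMap n) (ψ.cohomologyMap n)) ∧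
    (∀ n, Function.Exact (ψ.cohomologyMap n) (del n)) ∧
    (∀ n, Function.Exact (del n) (φ.cohomologyMap (n + 1)))

end Cohomology

/-! ### Dual complexes -/

section Dual

variable {𝕜 : Type*} [RCLike 𝕜]
variable {K : ℕ → Type*} [∀ n, NormedAddCommGroup (K n)] [∀ n, NormedSpace 𝕜 (K n)]
variable {L : ℕ → Type*} [∀ n, NormedAddCommGroup (L n)] [∀ n, NormedSpace 𝕜 (L n)]
variable {dK : ∀ n, K (n + 1) →L[𝕜] K n} {dL : ∀ n, L (n + 1) →L[𝕜] L n}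

/-- The differential of the dual cochain complex. -/
noncomputable def dualDifferential (d : ∀ n, K (n + 1) →L[𝕜] K n) (n : ℕ) :
    StrongDual 𝕜 (K n) →L[𝕜] StrongDual 𝕜 (K (n + 1)) :=
  dualOp (d n)

/-- The dual cochain map of a chain map. -/
noncomputable def ChainMap.dual (φ : ChainMap dK dL) :
    CochainMap (dualDifferential dL) (dualDifferential dK) where
  f n := dualOp (φ.f n)
  comm n g := by
    ext x
    exact congrArg g (φ.comm n x).symm

end Dual

/-! ### The simplicial and the bar complex of a Banach algebra -/

section Chains

variable (𝕜 : Type*) [RCLike 𝕜]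

/-- `C_n(A)`: the `(n + 1)`-fold projective tensor power of `A`, the completion of the algebraic
tensor power with respect to the projective norm (which is the norm that Mathlib puts on it). -/
abbrev Chains (A : Type*) [NormedAddCommGroup A] [NormedSpace 𝕜 A] (n : ℕ) :=
  UniformSpace.Completion (⨂[𝕜] _ : Fin (n + 1), A)

/-- The elementary tensor `a_0 ⊗ ⋯ ⊗ a_n` in `C_n(A)`. -/
noncomputable def pureTensor {A : Type*} [NormedAddCommGroup A] [NormedSpace 𝕜 A] {n : ℕ}
    (a : Fin (n + 1) → A) : Chains 𝕜 A n :=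
  ((⨂ₜ[𝕜] k, a k : ⨂[𝕜] _ : Fin (n + 1), A) : Chains 𝕜 A n)

variable (A : Type*) [NonUnitalNormedRing A] [NormedSpace 𝕜 A] [IsScalarTower 𝕜 A A]
  [SMulCommClass 𝕜 A A]

/-- Builds a continuous multilinear map `a ↦ ⨂ₜ φ a` from a continuous `φ` such that each
`φ a k` depends linearly on each of the entries of `a`, which moreover occurs only once. -/
noncomputable def multilinearOfEntries {m n : ℕ} (φ : (Fin m → A) → Fin n → A)
    (hφ : Continuous φ)
    (h : ∀ (a : Fin m → A) (p : Fin m), ∃ (k : Fin n) (T : A →ₗ[𝕜] A), ∀ x,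
      φ (Function.update a p x) = Function.update (φ a) k (T x)) :
    ContinuousMultilinearMap 𝕜 (fun _ : Fin m => A) (⨂[𝕜] _ : Fin n, A) where
  toFun a := ⨂ₜ[𝕜] k, φ a k
  map_update_add' := by
    intro inst a p x y
    rw [Subsingleton.elim inst (instDecidableEqFin m)]
    obtain ⟨k, T, hT⟩ := h a p
    simp only [hT, map_add]
    exact (PiTensorProduct.tprod 𝕜).map_update_add (φ a) k (T x) (T y)
  map_update_smul' := by
    intro inst a p c x
    rw [Subsingleton.elim inst (instDecidableEqFin m)]
    obtain ⟨k, T, hT⟩ := h a p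
    simp only [hT, map_smul]
    exact (PiTensorProduct.tprod 𝕜).map_update_smul (φ a) k c (T x)
  cont := (PiTensorProduct.tprodL 𝕜 (E := fun _ : Fin n => A)).cont.comp hφ

/-- `(a_0, …, a_{n+1}) ↦ (a_0, …, a_j a_{j+1}, …, a_{n+1})`, for `0 ≤ j ≤ n`. -/
def innerFace {n : ℕ} (j : Fin (n + 1)) (a : Fin (n + 2) → A) : Fin (n + 1) → A :=
  Fin.contractNth j.castSucc (· * ·) a

/-- `(a_0, …, a_{n+1}) ↦ (a_{n+1} a_0, a_1, …, a_n)`. -/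
def cyclicFace {n : ℕ} (a : Fin (n + 2) → A) : Fin (n + 1) → A :=
  Function.update (Fin.init a) 0 (a (Fin.last (n + 1)) * a 0)

variable {A}

theorem continuous_innerFace {n : ℕ} (j : Fin (n + 1)) : Continuous (innerFace A j) := by
  refine continuous_pi fun k => ?_
  unfold innerFace Fin.contractNth
  split_ifs <;> fun_prop

theorem continuous_cyclicFace {n : ℕ} : Continuous (cyclicFace A (n := n)) := by
  unfold cyclicFace Fin.init
  fun_prop

theorem innerFace_update {n : ℕ} (j : Fin (n + 1)) (a : Fin (n + 2) → A) (p : Fin (n + 2)) :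
    ∃ (k : Fin (n + 1)) (T : A →ₗ[𝕜] A), ∀ x,
      innerFace A j (Function.update a p x) = Function.update (innerFace A j a) k (T x) := by
  obtain ⟨j, hj⟩ := j
  obtain ⟨p, hp⟩ := p
  rcases lt_trichotomy p j with h | h | h
  · refine ⟨⟨p, by omega⟩, LinearMap.id, fun x => funext fun l => ?_⟩
    simp only [innerFace, Fin.contractNth, Function.update_apply, Fin.ext_iff, Fin.val_castSucc,
      Fin.val_succ, LinearMap.id_apply]
    split_ifs <;> first | rfl | omega
  · refine ⟨⟨j, hj⟩, LinearMap.mulRight 𝕜 (a ⟨j + 1, by omega⟩), fun x => funext fun l => ?_⟩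
    simp only [innerFace, Fin.contractNth, Function.update_apply, Fin.ext_iff, Fin.val_castSucc,
      Fin.val_succ, LinearMap.mulRight_apply]
    split_ifs <;> first | rfl | omega | (congr 2; apply Fin.ext; simp; omega)
  · by_cases h' : p = j + 1
    · refine ⟨⟨j, hj⟩, LinearMap.mulLeft 𝕜 (a ⟨j, by omega⟩), fun x => funext fun l => ?_⟩
      simp only [innerFace, Fin.contractNth, Function.update_apply, Fin.ext_iff,
        Fin.val_castSucc, Fin.val_succ, LinearMap.mulLeft_apply]
      split_ifs <;> first | rfl | omega | (congr 2; apply Fin.ext; simp; omega)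
    · refine ⟨⟨p - 1, by omega⟩, LinearMap.id, fun x => funext fun l => ?_⟩
      simp only [innerFace, Fin.contractNth, Function.update_apply, Fin.ext_iff,
        Fin.val_castSucc, Fin.val_succ, LinearMap.id_apply]
      split_ifs <;> first | rfl | omega

theorem cyclicFace_update {n : ℕ} (a : Fin (n + 2) → A) (p : Fin (n + 2)) :
    ∃ (k : Fin (n + 1)) (T : A →ₗ[𝕜] A), ∀ x,
      cyclicFace A (Function.update a p x) = Function.update (cyclicFace A a) k (T x) := by
  obtain ⟨p, hp⟩ := p
  by_cases h : p = 0
  · refine ⟨0, LinearMap.mulLeft 𝕜 (a (Fin.last (n + 1))), fun x => funext fun l => ?_⟩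
    simp only [cyclicFace, Fin.init, Function.update_apply, Fin.ext_iff, Fin.val_castSucc,
      Fin.val_last, Fin.val_zero, LinearMap.mulLeft_apply]
    split_ifs <;> first | rfl | omega
  · by_cases h' : p = n + 1
    · refine ⟨0, LinearMap.mulRight 𝕜 (a 0), fun x => funext fun l => ?_⟩
      simp only [cyclicFace, Fin.init, Function.update_apply, Fin.ext_iff, Fin.val_castSucc,
        Fin.val_last, Fin.val_zero, LinearMap.mulRight_apply]
      have := l.isLt
      split_ifs <;> first | rfl | omega
    · refine ⟨⟨p, by omega⟩, LinearMap.id, fun x => funext fun l => ?_⟩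
      simp only [cyclicFace, Fin.init, Function.update_apply, Fin.ext_iff, Fin.val_castSucc,
        Fin.val_last, Fin.val_zero, LinearMap.id_apply]
      split_ifs <;> first | rfl | omega

variable (A)

/-- The operator `a_0 ⊗ ⋯ ⊗ a_{n+1} ↦ a_0 ⊗ ⋯ ⊗ a_j a_{j+1} ⊗ ⋯ ⊗ a_{n+1}`. -/
noncomputable def innerFaceOp (n : ℕ) (j : Fin (n + 1)) : Chains 𝕜 A (n + 1) →L[𝕜] Chains 𝕜 A n :=
  (PiTensorProduct.liftIsometry 𝕜 _ _ (multilinearOfEntries 𝕜 A (innerFace A j)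
    (continuous_innerFace j) (innerFace_update 𝕜 j))).completion

/-- The operator `a_0 ⊗ ⋯ ⊗ a_{n+1} ↦ a_{n+1} a_0 ⊗ a_1 ⊗ ⋯ ⊗ a_n`. -/
noncomputable def cyclicFaceOp (n : ℕ) : Chains 𝕜 A (n + 1) →L[𝕜] Chains 𝕜 A n :=
  (PiTensorProduct.liftIsometry 𝕜 _ _ (multilinearOfEntries 𝕜 A (cyclicFace A)
    continuous_cyclicFace (cyclicFace_update 𝕜))).completion

/-- The differential `dr_n : C_{n+1}(A) → C_n(A)` of the bar complex,
`a_0 ⊗ ⋯ ⊗ a_{n+1} ↦ ∑_{0 ≤ j ≤ n} (-1)^j a_0 ⊗ ⋯ ⊗ a_j a_{j+1} ⊗ ⋯ ⊗ a_{n+1}`. -/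
noncomputable def barD (n : ℕ) : Chains 𝕜 A (n + 1) →L[𝕜] Chains 𝕜 A n :=
  ∑ j : Fin (n + 1), (-1 : 𝕜) ^ (j : ℕ) • innerFaceOp 𝕜 A n j

/-- The differential `d_n : C_{n+1}(A) → C_n(A)` of the simplicial complex,
`a_0 ⊗ ⋯ ⊗ a_{n+1} ↦ ∑_{0 ≤ j ≤ n} (-1)^j a_0 ⊗ ⋯ ⊗ a_j a_{j+1} ⊗ ⋯ ⊗ a_{n+1}
  + (-1)^{n+1} a_{n+1} a_0 ⊗ a_1 ⊗ ⋯ ⊗ a_n`. -/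
noncomputable def simplicialD (n : ℕ) : Chains 𝕜 A (n + 1) →L[𝕜] Chains 𝕜 A n :=
  barD 𝕜 A n + (-1 : 𝕜) ^ (n + 1) • cyclicFaceOp 𝕜 A n

/-- The Banach simplicial homology group `H_n(A)`. -/
abbrev SimplicialHomology (n : ℕ) := Homology (simplicialD 𝕜 A) n

/-- The Banach simplicial cohomology group `H^n(A)`. -/
abbrev SimplicialCohomology (n : ℕ) := Cohomology (dualDifferential (simplicialD 𝕜 A)) n

/-- The Banach bar homology group `HR_n(A)`. -/
abbrev BarHomology (n : ℕ) := Homology (barD 𝕜 A) n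

/-- The Banach bar cohomology group `HR^n(A)`. -/
abbrev BarCohomology (n : ℕ) := Cohomology (dualDifferential (barD 𝕜 A)) n

variable {A}

theorem innerFaceOp_pureTensor (n : ℕ) (j : Fin (n + 1)) (a : Fin (n + 2) → A) :
    innerFaceOp 𝕜 A n j (pureTensor 𝕜 a) = pureTensor 𝕜 (innerFace A j a) := by
  unfold innerFaceOp pureTensor
  rw [ContinuousLinearMap.completion_apply_coe, PiTensorProduct.liftIsometry_apply_apply,
    PiTensorProduct.lift.tprod]
  rfl

theorem cyclicFaceOp_pureTensor (n : ℕ) (a : Fin (n + 2) → A) :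
    cyclicFaceOp 𝕜 A n (pureTensor 𝕜 a) = pureTensor 𝕜 (cyclicFace A a) := by
  unfold cyclicFaceOp pureTensor
  rw [ContinuousLinearMap.completion_apply_coe, PiTensorProduct.liftIsometry_apply_apply,
    PiTensorProduct.lift.tprod]
  rfl

theorem barD_pureTensor (n : ℕ) (a : Fin (n + 2) → A) :
    barD 𝕜 A n (pureTensor 𝕜 a) =
      ∑ j : Fin (n + 1), (-1 : 𝕜) ^ (j : ℕ) • pureTensor 𝕜 (innerFace A j a) := by
  simp [barD, innerFaceOp_pureTensor]

theorem simplicialD_pureTensor (n : ℕ) (a : Fin (n + 2) → A) :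
    simplicialD 𝕜 A n (pureTensor 𝕜 a) =
      ∑ j : Fin (n + 1), (-1 : 𝕜) ^ (j : ℕ) • pureTensor 𝕜 (innerFace A j a) +
        (-1 : 𝕜) ^ (n + 1) • pureTensor 𝕜 (cyclicFace A a) := by
  simp [simplicialD, barD_pureTensor, cyclicFaceOp_pureTensor]

end Chains

/-! ### Functoriality and extensions -/

section Extension

set_option linter.unusedSectionVars false

variable {𝕜 : Type*} [RCLike 𝕜]

/-- The operator `f ⊗ ⋯ ⊗ f : C_n(A) → C_n(B)` induced by a continuous operator `f : A → B`. -/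
noncomputable def chainsMap {A : Type*} [NormedAddCommGroup A] [NormedSpace 𝕜 A]
    {B : Type*} [NormedAddCommGroup B] [NormedSpace 𝕜 B] (f : A →L[𝕜] B) (n : ℕ) :
    Chains 𝕜 A n →L[𝕜] Chains 𝕜 B n :=
  (PiTensorProduct.mapL fun _ : Fin (n + 1) => f).completion

theorem chainsMap_pureTensor {A : Type*} [NormedAddCommGroup A] [NormedSpace 𝕜 A]
    {B : Type*} [NormedAddCommGroup B] [NormedSpace 𝕜 B] (f : A →L[𝕜] B) (n : ℕ)
    (a : Fin (n + 1) → A) :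
    chainsMap f n (pureTensor 𝕜 a) = pureTensor 𝕜 (f ∘ a) := by
  unfold chainsMap pureTensor
  rw [ContinuousLinearMap.completion_apply_coe, PiTensorProduct.mapL_apply,
    PiTensorProduct.map_tprod]
  rfl

/-- Continuous operators on `C_n(A)` are determined by their values on elementary tensors. -/
theorem chains_ext {A : Type*} [NormedAddCommGroup A] [NormedSpace 𝕜 A] {n : ℕ}
    {F : Type*} [NormedAddCommGroup F] [NormedSpace 𝕜 F] {S T : Chains 𝕜 A n →L[𝕜] F}
    (h : ∀ a, S (pureTensor 𝕜 a) = T (pureTensor 𝕜 a)) : S = T := by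
  ext x
  induction x using UniformSpace.Completion.induction_on with
  | hp => exact isClosed_eq S.continuous T.continuous
  | ih x =>
    induction x using PiTensorProduct.induction_on with
    | smul_tprod r a =>
      rw [UniformSpace.Completion.coe_smul, map_smul, map_smul]
      exact congrArg (r • ·) (h a)
    | add x y hx hy => rw [UniformSpace.Completion.coe_add, map_add, map_add, hx, hy]

variable {B : Type*} [NonUnitalNormedRing B] [NormedSpace 𝕜 B] [IsScalarTower 𝕜 B B]
  [SMulCommClass 𝕜 B B]
variable {A : Type*} [NonUnitalNormedRing A] [NormedSpace 𝕜 A] [IsScalarTower 𝕜 A A]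
  [SMulCommClass 𝕜 A A]
variable {D : Type*} [NonUnitalNormedRing D] [NormedSpace 𝕜 D] [IsScalarTower 𝕜 D D]
  [SMulCommClass 𝕜 D D]

theorem comp_innerFace (f : A →L[𝕜] B) (hf : ∀ x y, f (x * y) = f x * f y) {n : ℕ}
    (j : Fin (n + 1)) (a : Fin (n + 2) → A) : f ∘ innerFace A j a = innerFace B j (f ∘ a) :=
  Fin.comp_contractNth _ _ hf _ _

theorem comp_cyclicFace (f : A →L[𝕜] B) (hf : ∀ x y, f (x * y) = f x * f y) {n : ℕ}
    (a : Fin (n + 2) → A) : f ∘ cyclicFace A a = cyclicFace B (f ∘ a) := by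
  unfold cyclicFace
  rw [Function.comp_update, hf]
  rfl

/-- The chain map of bar complexes induced by a continuous homomorphism. -/
noncomputable def barMap (f : A →L[𝕜] B) (hf : ∀ x y, f (x * y) = f x * f y) :
    ChainMap (barD 𝕜 A) (barD 𝕜 B) where
  f := chainsMap f
  comm n := by
    have : chainsMap f n ∘L barD 𝕜 A n = barD 𝕜 B n ∘L chainsMap f (n + 1) := chains_ext fun a => by
      simp [barD_pureTensor, chainsMap_pureTensor, comp_innerFace f hf]
    exact fun x => DFunLike.congr_fun this x

/-- The chain map of simplicial complexes induced by a continuous homomorphism. -/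
noncomputable def simplicialMap (f : A →L[𝕜] B) (hf : ∀ x y, f (x * y) = f x * f y) :
    ChainMap (simplicialD 𝕜 A) (simplicialD 𝕜 B) where
  f := chainsMap f
  comm n := by
    have : chainsMap f n ∘L simplicialD 𝕜 A n = simplicialD 𝕜 B n ∘L chainsMap f (n + 1) :=
      chains_ext fun a => by
        simp [simplicialD_pureTensor, chainsMap_pureTensor, comp_innerFace f hf,
          comp_cyclicFace f hf]
    exact fun x => DFunLike.congr_fun this x

variable (𝕜 B A D) in
/-- An extension `0 → B → A → D → 0` of Banach algebras: a short exact sequence of continuous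
algebra homomorphisms. -/
structure BanachAlgebraExtension where
  i : B →L[𝕜] A
  j : A →L[𝕜] D
  i_mul : ∀ x y, i (x * y) = i x * i y
  j_mul : ∀ x y, j (x * y) = j x * j y
  isShortExact : IsShortExact i j

namespace BanachAlgebraExtension

/-- The extension is weakly admissible: the dual sequence of Banach spaces splits. -/
def WeaklyAdmissible (E : BanachAlgebraExtension 𝕜 B A D) : Prop :=
  IsWeaklyAdmissible E.i E.j

/-- There is an associated long exact sequence of Banach simplicial homology groups. -/
def HasSimplicialHomologySequence (E : BanachAlgebraExtension 𝕜 B A D) : Prop :=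
  HasLongExactHomology (simplicialMap E.i E.i_mul) (simplicialMap E.j E.j_mul)

/-- There is an associated long exact sequence of Banach simplicial cohomology groups. -/
def HasSimplicialCohomologySequence (E : BanachAlgebraExtension 𝕜 B A D) : Prop :=
  HasLongExactCohomology (simplicialMap E.j E.j_mul).dual (simplicialMap E.i E.i_mul).dual

/-- There is an associated long exact sequence of Banach bar homology groups. -/
def HasBarHomologySequence (E : BanachAlgebraExtension 𝕜 B A D) : Prop :=
  HasLongExactHomology (barMap E.i E.i_mul) (barMap E.j E.j_mul)

/-- There is an associated long exact sequence of Banach bar cohomology groups. -/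
def HasBarCohomologySequence (E : BanachAlgebraExtension 𝕜 B A D) : Prop :=
  HasLongExactCohomology (barMap E.j E.j_mul).dual (barMap E.i E.i_mul).dual

end BanachAlgebraExtension

end Extension

end BanachHomology

open scoped TensorProduct

/-! Let `φ : K → L` and `ψ : L → M` be the chain maps induced by `i` and `j` on the simplicial or
the bar complexes. The composite `ψ ∘ φ` vanishes, but `ker ψ` is usually larger than `im φ`: a
tensor with just one factor from `B` already dies in the tensor powers of `D`. The obstruction is
the subquotient complex `ker ψ / im φ`. When `φ` is injective and `ψ` surjective, a diagram chase
shows that the long homology sequence, with the zigzag as connecting map, exists exactly when this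
complex is exact (`IsExactBetween.hasLongExactHomology`, `HasLongExactHomology.isExactBetween`). The
same chase for the dual complexes gives the condition that `ker φ^* / im ψ^*` is exact.

If `φ` has closed range, `ker ψ / im φ` is a complex of Banach spaces, and by Hahn-Banach and the
open mapping theorem its dual is `ker φ^* / im ψ^*` (`IsSubquotient.isCoexactBetween_dual_iff`). A
complex of Banach spaces is exact if and only if its dual is (`isExactComplex_iff_dual`), so the two
conditions agree.

What remains concerns tensor powers. A continuous right inverse of `i^*` extends multilinear forms
from `B` to `A` one variable at a time, so `φ^*` is surjective and `φ` is bounded below, hence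
injective with closed range (`surjective_dualOp_chainsMap`, `antilipschitz_of_surjective_dual`).
Surjectivity of `ψ` comes from lifting elementary tensors with norm control
(`surjective_chainsMap`). -/

namespace BanachHomology

/-! ### Duality for operators with closed range. -/

section BanachSpaces

variable {𝕜 : Type*} [RCLike 𝕜]
variable {X : Type*} [NormedAddCommGroup X] [NormedSpace 𝕜 X]
variable {Y : Type*} [NormedAddCommGroup Y] [NormedSpace 𝕜 Y]
variable {Z : Type*} [NormedAddCommGroup Z] [NormedSpace 𝕜 Z]

/-- If the dual of `T` is bounded below, then the image under `T` of the ball of radius `C * ‖y‖`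
is dense around `y`. -/
theorem mem_closure_image_closedBall (T : X →L[𝕜] Y) {C : ℝ} (hC : 0 < C)
    (hT : ∀ f : StrongDual 𝕜 Y, ‖f‖ ≤ C * ‖dualOp T f‖) {y : Y} (hy : y ≠ 0) :
    y ∈ closure (T '' Metric.closedBall 0 (C * ‖y‖)) := by
  by_contra h
  let : NormedSpace ℝ X := NormedSpace.restrictScalars ℝ 𝕜 X
  let : NormedSpace ℝ Y := NormedSpace.restrictScalars ℝ 𝕜 Y
  have : IsScalarTower ℝ 𝕜 X := .of_algebraMap_smul fun _ _ => rfl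
  have : IsScalarTower ℝ 𝕜 Y := .of_algebraMap_smul fun _ _ => rfl
  have hconv : Convex ℝ (closure (T '' Metric.closedBall 0 (C * ‖y‖))) :=
    ((convex_closedBall (0 : X) _).linear_image (T.toLinearMap.restrictScalars ℝ)).closure
  obtain ⟨f, u, hf, hu⟩ := RCLike.geometric_hahn_banach_closed_point (𝕜 := 𝕜) hconv
    isClosed_closure h
  have hr : 0 < C * ‖y‖ := mul_pos hC (norm_pos_iff.2 hy)
  have hball : ∀ x ∈ Metric.closedBall (0 : X) (C * ‖y‖), ‖dualOp T f x‖ ≤ u := by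
    intro x hx
    -- The ball is stable under unimodular scalars, so rotating `x` turns the one-sided bound on the
    -- real part into a bound on the norm.
    obtain ⟨c, hc, hcx⟩ := RCLike.exists_norm_eq_mul_self (dualOp T f x)
    have hcx' : c • x ∈ Metric.closedBall (0 : X) (C * ‖y‖) := by
      simpa [norm_smul, hc] using hx
    have := hf _ (subset_closure ⟨_, hcx', rfl⟩)
    rw [map_smul, map_smul, smul_eq_mul, ← dualOp_apply, ← hcx, RCLike.ofReal_re] at this
    exact this.le
  have h1 : ‖dualOp T f‖ ≤ u / (C * ‖y‖) :=
    ContinuousLinearMap.opNorm_bound_of_ball_bound hr u _ hball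
  rw [le_div_iff₀ hr] at h1
  have h2 : RCLike.re (f y) ≤ C * ‖dualOp T f‖ * ‖y‖ :=
    (RCLike.re_le_norm _).trans <| (f.le_opNorm y).trans <| by gcongr; exact hT f
  nlinarith

/-- An operator on a Banach space whose dual is bounded below is surjective. -/
theorem surjective_of_norm_le_dual [CompleteSpace X] (T : X →L[𝕜] Y) {C : ℝ} (hC : 0 < C)
    (hT : ∀ f : StrongDual 𝕜 Y, ‖f‖ ≤ C * ‖dualOp T f‖) : Function.Surjective T := by
  have approx : ∀ y, ∃ x, ‖y - T x‖ ≤ 1 / 2 * ‖y‖ ∧ ‖x‖ ≤ C * ‖y‖ := by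
    intro y
    rcases eq_or_ne y 0 with rfl | hy
    · exact ⟨0, by simp, by simp⟩
    · obtain ⟨_, ⟨x, hx, rfl⟩, hxy⟩ := Metric.mem_closure_iff.1
        (mem_closure_image_closedBall T hC hT hy) (1 / 2 * ‖y‖) (by positivity)
      exact ⟨x, by rw [← dist_eq_norm]; exact hxy.le, by simpa using hx⟩
  choose g hg using approx
  intro y
  -- Successive approximation: `h` is the error left by one approximate preimage and at least halves
  -- the norm. The corrections `g (h^[n] y)` are summable and their sum is an exact preimage.
  let h : Y → Y := fun y => y - T (g y)
  have hnle : ∀ n : ℕ, ‖h^[n] y‖ ≤ (1 / 2) ^ n * ‖y‖ := by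
    intro n
    induction n with
    | zero => simp
    | succ n ih =>
      rw [Function.iterate_succ_apply', pow_succ', mul_assoc]
      exact (hg _).1.trans (by gcongr)
  have hsum : Summable fun n => g (h^[n] y) := by
    refine .of_norm_bounded (g := fun n : ℕ => (1 / 2 : ℝ) ^ n * (C * ‖y‖))
      (summable_geometric_two.mul_right _) fun n => (hg _).2.trans ?_
    calc C * ‖h^[n] y‖ ≤ C * ((1 / 2) ^ n * ‖y‖) := by gcongr; exact hnle n
      _ = (1 / 2) ^ n * (C * ‖y‖) := by ring
  have hpart : ∀ n : ℕ, T (∑ i ∈ Finset.range n, g (h^[i] y)) = y - h^[n] y := by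
    intro n
    induction n with
    | zero => simp
    | succ n ih =>
      rw [Finset.sum_range_succ, map_add, ih, Function.iterate_succ_apply']
      simp only [h]
      abel
  have hlim := (T.continuous.tendsto _).comp hsum.hasSum.tendsto_sum_nat
  have hzero : Filter.Tendsto (fun n => h^[n] y) Filter.atTop (nhds 0) := by
    refine squeeze_zero_norm hnle ?_
    simpa using (tendsto_pow_atTop_nhds_zero_of_lt_one (r := (1 / 2 : ℝ)) (by norm_num)
      (by norm_num)).mul_const ‖y‖
  refine ⟨_, tendsto_nhds_unique hlim ?_⟩
  simpa only [Function.comp_def, hpart, sub_zero] using tendsto_const_nhds.sub hzero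

/-- If the dual of `T` is surjective, then `T` is bounded below. -/
theorem antilipschitz_of_surjective_dual (T : X →L[𝕜] Y)
    (hT : Function.Surjective (dualOp T)) : ∃ C, AntilipschitzWith C T := by
  obtain ⟨C, hC, h⟩ := (dualOp T).exists_preimage_norm_le hT
  refine ⟨⟨C, hC.le⟩, AddMonoidHomClass.antilipschitz_of_bound T fun x => ?_⟩
  -- A norming functional `f` of `x` is pulled back from some `g` with `‖g‖ ≤ C * ‖f‖`, so `‖x‖ = ‖g
  -- (T x)‖` is controlled by `‖T x‖`.
  obtain ⟨f, hf, hfx⟩ := exists_dual_vector'' 𝕜 x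
  obtain ⟨g, rfl, hg⟩ := h f
  rw [dualOp_apply] at hfx
  calc ‖x‖ = ‖g (T x)‖ := by rw [hfx, RCLike.norm_ofReal, abs_of_nonneg (norm_nonneg x)]
    _ ≤ ‖g‖ * ‖T x‖ := g.le_opNorm _
    _ ≤ C * ‖T x‖ := by
      gcongr
      exact hg.trans (mul_le_of_le_one_right hC.le hf)

/-- An operator with closed range admits preimages of controlled norm. -/
theorem exists_norm_le_of_isClosed_range [CompleteSpace Y] [CompleteSpace Z] (S : Y →L[𝕜] Z)
    (hS : IsClosed (Set.range S)) :
    ∃ C : ℝ, 0 < C ∧ ∀ y, ∃ y', S y' = S y ∧ ‖y'‖ ≤ C * ‖S y‖ := by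
  have hS' : IsClosed (LinearMap.range S.toLinearMap : Set Z) := hS
  have : CompleteSpace (LinearMap.range S.toLinearMap) := hS'.completeSpace_coe
  obtain ⟨C, hC, hpre⟩ := ContinuousLinearMap.exists_preimage_norm_le
    (S.codRestrict (LinearMap.range S.toLinearMap) fun y => ⟨y, rfl⟩)
    (by rintro ⟨_, y, rfl⟩; exact ⟨y, rfl⟩)
  refine ⟨C, hC, fun y => ?_⟩
  obtain ⟨y', hy', hn⟩ := hpre ⟨S y, y, rfl⟩
  exact ⟨y', congrArg Subtype.val hy', hn⟩

/-- A functional vanishing on the kernel of an operator with closed range factors through that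
operator. -/
theorem exists_dualOp_eq_of_ker_le [CompleteSpace Y] [CompleteSpace Z] (S : Y →L[𝕜] Z)
    (hS : IsClosed (Set.range S)) (g : StrongDual 𝕜 Y) (hg : ∀ y, S y = 0 → g y = 0) :
    ∃ h : StrongDual 𝕜 Z, dualOp S h = g := by
  obtain ⟨C, hC, hpre⟩ := exists_norm_le_of_isClosed_range S hS
  choose p hp hpn using hpre
  have hgp : ∀ y v, S y = S v → g y = g v := fun y v h => by
    rw [← sub_eq_zero, ← map_sub]
    exact hg _ (by rw [map_sub, h, sub_self])
  have hch : ∀ z : LinearMap.range S.toLinearMap, ∃ y, S y = z := fun z => z.2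
  choose q hq using hch
  let l : LinearMap.range S.toLinearMap →ₗ[𝕜] 𝕜 :=
    { toFun := fun z => g (q z)
      map_add' := fun z w => by
        rw [← map_add]
        exact hgp _ _ (by rw [map_add, hq, hq, hq]; rfl)
      map_smul' := fun c z => by
        rw [RingHom.id_apply, ← map_smul]
        exact hgp _ _ (by rw [map_smul, hq, hq]; rfl) }
  let f : StrongDual 𝕜 (LinearMap.range S.toLinearMap) :=
    l.mkContinuous (‖g‖ * C) fun z => by
      change ‖g (q z)‖ ≤ _
      -- The preimage `q z` carries no norm bound; `p (q z)` has the same image under `S`, hence the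
      -- same value of `g`, and a controlled norm.
      rw [← hgp _ _ (hp (q z)), mul_assoc]
      refine (g.le_opNorm _).trans ?_
      gcongr
      refine (hpn (q z)).trans_eq ?_
      rw [hq]
      rfl
  obtain ⟨h, hh, -⟩ := exists_extension_norm_eq _ f
  exact ⟨h, ContinuousLinearMap.ext fun y => 
    (hh ⟨S y, y, rfl⟩).trans (hgp _ _ (hq _))⟩

/-- If the dual of `X → Y → Z` is exact and `Y^* → X^*` has closed range, then
`X → Y → Z` is exact. -/
theorem exists_preimage_of_dual_exact [CompleteSpace X] [CompleteSpace Y] (T : X →L[𝕜] Y)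
    (S : Y →L[𝕜] Z) (hST : ∀ x, S (T x) = 0) (hT : IsClosed (Set.range (dualOp T)))
    (hex : ∀ g, dualOp T g = 0 → ∃ h, dualOp S h = g) (y : Y) (hy : S y = 0) :
    ∃ x, T x = y := by
  let N := LinearMap.ker S.toLinearMap
  let T' : X →L[𝕜] N := T.codRestrict N hST
  obtain ⟨C, hC, hpre⟩ := exists_norm_le_of_isClosed_range (dualOp T) hT
  have key : ∀ f : StrongDual 𝕜 N, ‖f‖ ≤ C * ‖dualOp T' f‖ := by
    intro f
    obtain ⟨g, hg, -⟩ := exists_extension_norm_eq N f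
    have hgf : dualOp T g = dualOp T' f := ContinuousLinearMap.ext fun x => hg (T' x)
    -- Replace the extension `g` of `f` by one of norm controlled by `dualOp T' f`. The difference
    -- `g - g'` factors through `S`, so it vanishes on `N` and `g'` still restricts to `f`.
    obtain ⟨g', hgg', hn⟩ := hpre g
    obtain ⟨h, hh⟩ := hex (g - g') (by rw [map_sub, hgg', sub_self])
    have hfg' : ∀ z : N, f z = g' z := fun z => by
      rw [← hg z, ← sub_eq_zero, ← sub_apply, ← hh, dualOp_apply,
        show S z = 0 from z.2, map_zero]
    rw [hgf] at hn
    refine le_trans (f.opNorm_le_bound (norm_nonneg g') fun z => ?_) hn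
    rw [hfg' z]
    exact g'.le_opNorm _
  obtain ⟨x, hx⟩ := surjective_of_norm_le_dual T' hC key ⟨y, hy⟩
  exact ⟨x, congrArg Subtype.val hx⟩

end BanachSpaces

/-! ### Exactness of a Banach complex and of its dual. -/

section ExactComplexes

variable {𝕜 : Type*} [RCLike 𝕜]
variable {X : ℕ → Type*} [∀ n, NormedAddCommGroup (X n)] [∀ n, NormedSpace 𝕜 (X n)]
  [∀ n, CompleteSpace (X n)]

/-- The complex `0 ← X 0 ← X 1 ← ⋯` is exact. -/
def IsExactComplex (d : ∀ n, X (n + 1) →L[𝕜] X n) : Prop :=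
  Function.Surjective (d 0) ∧ ∀ n x, d n x = 0 → ∃ w, d (n + 1) w = x

/-- The dual of the complex `0 ← X 0 ← X 1 ← ⋯` is exact. -/
def IsDualExactComplex (d : ∀ n, X (n + 1) →L[𝕜] X n) : Prop :=
  Function.Injective (dualOp (d 0)) ∧
    ∀ n g, dualOp (d (n + 1)) g = 0 → ∃ h, dualOp (d n) h = g

/-- A complex of Banach spaces is exact if and only if its dual is exact. -/
theorem isExactComplex_iff_dual (d : ∀ n, X (n + 1) →L[𝕜] X n)
    (hd : ∀ n x, d n (d (n + 1) x) = 0) : IsExactComplex d ↔ IsDualExactComplex d := by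
  constructor
  · rintro ⟨hsurj, hex⟩
    -- Exactness makes every image a kernel, or the whole space in degree `0`, so the closed range
    -- hypothesis is automatic.
    have hclosed : ∀ n, IsClosed (Set.range (d n)) := by
      rintro (_ | n)
      · rw [hsurj.range_eq]
        exact isClosed_univ
      · have : Set.range (d (n + 1)) = d n ⁻¹' {0} := by
          ext x
          exact ⟨by rintro ⟨w, rfl⟩; exact hd n w, fun hx => hex n x hx⟩
        rw [this]
        exact isClosed_singleton.preimage (d n).continuous
    refine ⟨fun f g hfg => ContinuousLinearMap.ext fun x => ?_, fun n g hg => ?_⟩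
    · obtain ⟨w, rfl⟩ := hsurj x
      exact DFunLike.congr_fun hfg w
    · refine exists_dualOp_eq_of_ker_le (d n) (hclosed n) g fun y hy => ?_
      obtain ⟨w, rfl⟩ := hex n y hy
      exact DFunLike.congr_fun hg w
  · rintro ⟨hinj, hex⟩
    have hclosed : ∀ n, IsClosed (Set.range (dualOp (d n))) := by
      intro n
      have : Set.range (dualOp (d n)) = dualOp (d (n + 1)) ⁻¹' {0} := by
        ext g
        refine ⟨?_, fun hg => hex n g hg⟩
        rintro ⟨h, rfl⟩
        refine ContinuousLinearMap.ext fun x => ?_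
        rw [dualOp_apply, dualOp_apply, hd, map_zero]
        rfl
      rw [this]
      exact isClosed_singleton.preimage (dualOp (d (n + 1))).continuous
    refine ⟨fun y => ?_, fun n x hx => ?_⟩
    -- Surjectivity of `d 0` is exactness at `X 0` with the zero operator as the outgoing map.
    · refine exists_preimage_of_dual_exact (d 0) (0 : X 0 →L[𝕜] X 0) (fun _ => rfl) (hclosed 0)
        (fun g hg => ⟨0, ?_⟩) y rfl
      rw [map_zero, hinj (hg.trans (map_zero _).symm)]
    · exact exists_preimage_of_dual_exact (d (n + 1)) (d n) (hd n) (hclosed (n + 1)) (hex n) x hx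

end ExactComplexes

/-- A total, single-valued linear relation is the graph of a linear map. -/
theorem exists_linearMap_of_relation {R V W : Type*} [Ring R] [AddCommGroup V] [Module R V]
    [AddCommGroup W] [Module R W] (G : Submodule R (V × W)) (htotal : ∀ x, ∃ y, (x, y) ∈ G)
    (hzero : ∀ y, (0, y) ∈ G → y = 0) : ∃ f : V →ₗ[R] W, ∀ x y, f x = y ↔ (x, y) ∈ G := by
  choose f hf using htotal
  have huniq : ∀ x y, (x, y) ∈ G → f x = y := fun x y h => by
    have := G.sub_mem (hf x) h
    rw [Prod.mk_sub_mk, sub_self] at this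
    exact sub_eq_zero.1 (hzero _ this)
  refine ⟨{ toFun := f, map_add' := fun x y => huniq _ _ (G.add_mem (hf x) (hf y)),
            map_smul' := fun c x => huniq _ _ (G.smul_mem c (hf x)) },
    fun x y => ⟨?_, huniq x y⟩⟩
  rintro rfl
  exact hf x

/-! ### Long exact homology sequence and exactness of `ker ψ / im φ`. -/

section Homology

variable {𝕜 : Type*} [RCLike 𝕜]
variable {K : ℕ → Type*} [∀ n, NormedAddCommGroup (K n)] [∀ n, NormedSpace 𝕜 (K n)]
variable {L : ℕ → Type*} [∀ n, NormedAddCommGroup (L n)] [∀ n, NormedSpace 𝕜 (L n)]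
variable {M : ℕ → Type*} [∀ n, NormedAddCommGroup (M n)] [∀ n, NormedSpace 𝕜 (M n)]
variable {dK : ∀ n, K (n + 1) →L[𝕜] K n} {dL : ∀ n, L (n + 1) →L[𝕜] L n}
  {dM : ∀ n, M (n + 1) →L[𝕜] M n}

theorem homologyClass_surjective (d : ∀ n, K (n + 1) →L[𝕜] K n) (n : ℕ) :
    Function.Surjective (homologyClass d n) :=
  Submodule.mkQ_surjective _

theorem homologyClass_eq_zero {d : ∀ n, K (n + 1) →L[𝕜] K n} {n : ℕ} {z : cycles d n} :
    homologyClass d n z = 0 ↔ ∃ w, d n w = z :=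
  Submodule.Quotient.mk_eq_zero _

theorem homologyClass_eq {d : ∀ n, K (n + 1) →L[𝕜] K n} {n : ℕ} {z z' : cycles d n} :
    homologyClass d n z = homologyClass d n z' ↔ ∃ w, d n w = (z - z' : K n) := by
  rw [← sub_eq_zero, ← map_sub, homologyClass_eq_zero]
  rfl

theorem mem_cycles_of_injective (φ : ChainMap dK dL) (hφ : ∀ n, Function.Injective (φ.f n)) :
    ∀ {n : ℕ} {x : K n}, φ.f n x ∈ cycles dL n → x ∈ cycles dK n
  | 0, _, _ => Submodule.mem_top
  | n + 1, x, h => by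
    have h' : dL n (φ.f (n + 1) x) = 0 := h
    rw [← φ.comm] at h'
    exact hφ n (h'.trans (map_zero _).symm)

theorem boundary_mem_cycles {d : ∀ n, K (n + 1) →L[𝕜] K n} (hd : ∀ n x, d n (d (n + 1) x) = 0) :
    ∀ (n : ℕ) (x : K (n + 1)), d n x ∈ cycles d n
  | 0, _ => Submodule.mem_top
  | n + 1, x => hd n x

/-- The zigzag relation that defines the connecting homomorphism in homology. -/
def zigzag (φ : ChainMap dK dL) (ψ : ChainMap dL dM) (n : ℕ) :
    Submodule 𝕜 (Homology dM (n + 1) × Homology dK n) where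
  carrier := {p | ∃ (a : L (n + 1)) (z : cycles dM (n + 1)) (b : cycles dK n),
      ψ.f (n + 1) a = z ∧ dL n a = φ.f n b ∧ homologyClass dM (n + 1) z = p.1 ∧
        homologyClass dK n b = p.2}
  zero_mem' := ⟨0, 0, 0, by simp, by simp, by simp, by simp⟩
  add_mem' := by
    rintro ⟨_, _⟩ ⟨_, _⟩ ⟨a, z, b, h1, h2, rfl, rfl⟩ ⟨a', z', b', h1', h2', rfl, rfl⟩
    exact ⟨a + a', z + z', b + b', by simp [h1, h1'], by simp [h2, h2'], map_add _ _ _,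
      map_add _ _ _⟩
  smul_mem' := by
    rintro c ⟨_, _⟩ ⟨a, z, b, h1, h2, rfl, rfl⟩
    exact ⟨c • a, c • z, c • b, by simp [h1], by simp [h2], map_smul _ _ _, map_smul _ _ _⟩

/-- The subquotient complex `ker ψ / im φ` is exact. -/
def IsExactBetween (φ : ChainMap dK dL) (ψ : ChainMap dL dM) : Prop :=
  (∀ x, ψ.f 0 x = 0 → ∃ w b, ψ.f 1 w = 0 ∧ dL 0 w + φ.f 0 b = x) ∧
    ∀ n x, ψ.f (n + 1) x = 0 → (∃ b, dL n x = φ.f n b) →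
      ∃ w b, ψ.f (n + 2) w = 0 ∧ dL (n + 1) w + φ.f (n + 1) b = x

theorem IsExactBetween.exists_of_mem_cycles {φ : ChainMap dK dL} {ψ : ChainMap dL dM}
    (h : IsExactBetween φ ψ) : ∀ (n : ℕ) (x : L n), x ∈ cycles dL n → ψ.f n x = 0 →
      ∃ w b, ψ.f (n + 1) w = 0 ∧ dL n w + φ.f n b = x
  | 0, x, _, hx => h.1 x hx
  | n + 1, x, hc, hx => h.2 n x hx ⟨0, by rw [map_zero]; exact hc⟩

/-- This is the snake chase with one extra correction. Where one would use `ker ψ = im φ`, a chain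
of `ker ψ` whose boundary lies in `im φ` is instead moved into `im φ` by subtracting the boundary of
a chain of `ker ψ`, which is invisible in `M`. -/
theorem IsExactBetween.hasLongExactHomology {φ : ChainMap dK dL} {ψ : ChainMap dL dM}
    (hL : ∀ n x, dL n (dL (n + 1) x) = 0) (hφ : ∀ n, Function.Injective (φ.f n))
    (hψ : ∀ n, Function.Surjective (ψ.f n)) (hψφ : ∀ n x, ψ.f n (φ.f n x) = 0)
    (h : IsExactBetween φ ψ) : HasLongExactHomology φ ψ := by
  have htotal : ∀ n x, ∃ y, (x, y) ∈ zigzag φ ψ n := by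
    intro n x
    obtain ⟨z, rfl⟩ := homologyClass_surjective dM (n + 1) x
    obtain ⟨a, ha⟩ := hψ (n + 1) z
    have hz : dM n z = 0 := z.2
    -- `dL n a` need not come from `K`, but `dL n (a - w)` does, and `a - w` still lifts `z`.
    obtain ⟨w, b, hw, hb⟩ := h.exists_of_mem_cycles n (dL n a) (boundary_mem_cycles hL n a)
      (by rw [ψ.comm, ha, hz])
    have hb' : φ.f n b = dL n (a - w) := by rw [map_sub, ← hb, add_sub_cancel_left]
    have hbc : b ∈ cycles dK n := mem_cycles_of_injective φ hφ (by
      rw [hb']; exact boundary_mem_cycles hL n _)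
    exact ⟨homologyClass dK n ⟨b, hbc⟩, a - w, z, ⟨b, hbc⟩, by rw [map_sub, ha, hw, sub_zero],
      hb'.symm, rfl, rfl⟩
  have hzero : ∀ n y, (0, y) ∈ zigzag φ ψ n → y = 0 := by
    rintro n _ ⟨a, z, b, h1, h2, h3, rfl⟩
    obtain ⟨m, hm⟩ := homologyClass_eq_zero.1 h3
    obtain ⟨l, rfl⟩ := hψ _ m
    -- If `z` bounds, subtracting a lifted boundary puts `a` in `ker ψ` without changing its own
    -- boundary; the component `c` in `K` then bounds `b`.
    obtain ⟨w, c, hw, hc⟩ := h.2 n (a - dL (n + 1) l)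
      (by rw [map_sub, h1, ← hm, ψ.comm, sub_self]) ⟨b, by rw [map_sub, hL, sub_zero, h2]⟩
    refine homologyClass_eq_zero.2 ⟨c, hφ n ?_⟩
    have := congrArg (dL n) hc
    rw [map_add, map_sub, hL, hL, zero_add, sub_zero, h2] at this
    rw [φ.comm, this]
  choose del hdel using fun n => exists_linearMap_of_relation _ (htotal n) (hzero n)
  refine ⟨del, hdel, fun n x => ⟨?_, ?_⟩, fun n x => ⟨?_, ?_⟩, fun n y => ⟨?_, ?_⟩, ?_⟩
  · obtain ⟨x, rfl⟩ := homologyClass_surjective dL n x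
    intro hx
    rw [ψ.homologyMap_class] at hx
    obtain ⟨m, hm⟩ := homologyClass_eq_zero.1 hx
    obtain ⟨l, rfl⟩ := hψ _ m
    have hm' : dM n (ψ.f (n + 1) l) = ψ.f n x := hm
    obtain ⟨w, c, hw, hc⟩ := h.exists_of_mem_cycles n (x - dL n l)
      ((cycles dL n).sub_mem x.2 (boundary_mem_cycles hL n l))
      (by rw [map_sub, ψ.comm, hm', sub_self])
    have hc' : dL n (l + w) = x - φ.f n c := by
      rw [map_add, eq_sub_iff_add_eq, add_assoc, hc, add_sub_cancel]
    have hcc : c ∈ cycles dK n := mem_cycles_of_injective φ hφ (by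
      rw [eq_sub_of_add_eq' hc]
      exact (cycles dL n).sub_mem ((cycles dL n).sub_mem x.2 (boundary_mem_cycles hL n l))
        (boundary_mem_cycles hL n w))
    refine ⟨homologyClass dK n ⟨c, hcc⟩, ?_⟩
    rw [φ.homologyMap_class, eq_comm, homologyClass_eq]
    exact ⟨l + w, hc'⟩
  · rintro ⟨y, rfl⟩
    obtain ⟨y, rfl⟩ := homologyClass_surjective dK n y
    rw [φ.homologyMap_class, ψ.homologyMap_class]
    refine homologyClass_eq_zero.2 ⟨0, ?_⟩
    rw [map_zero]
    exact (hψφ n y).symm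
  · intro hx
    obtain ⟨a, z, b, h1, h2, rfl, h4⟩ := (hdel n x 0).1 hx
    obtain ⟨c, hc⟩ := homologyClass_eq_zero.1 h4
    have hac : a - φ.f (n + 1) c ∈ cycles dL (n + 1) := by
      change dL n _ = 0
      rw [map_sub, h2, ← hc, φ.comm, sub_self]
    refine ⟨homologyClass dL (n + 1) ⟨_, hac⟩, ?_⟩
    rw [ψ.homologyMap_class]
    refine congrArg _ (Subtype.ext ?_)
    change ψ.f (n + 1) (a - φ.f (n + 1) c) = z
    rw [map_sub, hψφ, sub_zero, h1]
  · rintro ⟨y, rfl⟩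
    obtain ⟨y, rfl⟩ := homologyClass_surjective dL (n + 1) y
    have hy : dL n y = 0 := y.2
    exact (hdel n _ 0).2 ⟨y, ψ.cyclesMap (n + 1) y, 0, rfl, by simp [hy], rfl, map_zero _⟩
  · obtain ⟨b, rfl⟩ := homologyClass_surjective dK n y
    intro hy
    rw [φ.homologyMap_class] at hy
    obtain ⟨l, hl⟩ := homologyClass_eq_zero.1 hy
    have hl' : dL n l = φ.f n b := hl
    have hz : ψ.f (n + 1) l ∈ cycles dM (n + 1) := by
      change dM n _ = 0
      rw [← ψ.comm, hl', hψφ]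
    exact ⟨homologyClass dM (n + 1) ⟨_, hz⟩, (hdel n _ _).2 ⟨l, ⟨_, hz⟩, b, rfl, hl', rfl, rfl⟩⟩
  · rintro ⟨x, rfl⟩
    obtain ⟨a, z, b, -, h2, -, h4⟩ := (hdel n x _).1 rfl
    have h4' : homologyClass dK n b = del n x := h4
    rw [← h4', φ.homologyMap_class]
    exact homologyClass_eq_zero.2 ⟨a, h2⟩
  · intro x
    obtain ⟨z, rfl⟩ := homologyClass_surjective dM 0 x
    obtain ⟨a, ha⟩ := hψ 0 z
    refine ⟨homologyClass dL 0 ⟨a, Submodule.mem_top⟩, ?_⟩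
    rw [ψ.homologyMap_class]
    exact congrArg _ (Subtype.ext ha)

/-- Only exactness at the homology of `L` and the zigzag description of `del` are needed: its being
defined everywhere settles the cycles in `ker ψ`, and its single-valuedness reduces the general case
to these. -/
theorem HasLongExactHomology.isExactBetween {φ : ChainMap dK dL} {ψ : ChainMap dL dM}
    (hL : ∀ n x, dL n (dL (n + 1) x) = 0) (hφ : ∀ n, Function.Injective (φ.f n))
    (hψ : ∀ n, Function.Surjective (ψ.f n)) (hψφ : ∀ n x, ψ.f n (φ.f n x) = 0)
    (h : HasLongExactHomology φ ψ) : IsExactBetween φ ψ := by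
  obtain ⟨del, hdel, hex, -, -, -⟩ := h
  have key : ∀ (n : ℕ) (x : L n), x ∈ cycles dL n → ψ.f n x = 0 →
      ∃ w b, ψ.f (n + 1) w = 0 ∧ dL n w + φ.f n b = x := by
    intro n x hxc hx
    obtain ⟨y, hy⟩ := (hex n (homologyClass dL n ⟨x, hxc⟩)).1 (by
      rw [ψ.homologyMap_class]
      refine homologyClass_eq_zero.2 ⟨0, ?_⟩
      rw [map_zero]
      exact hx.symm)
    obtain ⟨c, rfl⟩ := homologyClass_surjective dK n y
    rw [φ.homologyMap_class, eq_comm, homologyClass_eq] at hy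
    obtain ⟨l, hl⟩ := hy
    have hl' : dL n l = x - φ.f n c := hl
    have hz : ψ.f (n + 1) l ∈ cycles dM (n + 1) := by
      change dM n _ = 0
      rw [← ψ.comm, hl', map_sub, hx, hψφ, sub_zero]
    -- Since `del` has a value on the class of `ψ l`, some zigzag starts at that class. Its chain
    -- `a` agrees with `l` over `M` up to a boundary and has boundary in `im φ`, so `l` can be
    -- corrected to lie in `ker ψ`.
    obtain ⟨a, z, b, h1, h2, h3, -⟩ :=
      (hdel n (homologyClass dM (n + 1) ⟨_, hz⟩) _).1 rfl
    obtain ⟨m, hm⟩ := homologyClass_eq.1 h3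
    obtain ⟨l₂, rfl⟩ := hψ _ m
    refine ⟨l - a + dL (n + 1) l₂, c + b, ?_, ?_⟩
    · rw [map_add, map_sub, ψ.comm, hm, h1]
      abel
    · rw [map_add, map_sub, hL, hl', h2, map_add]
      abel
  refine ⟨fun x hx => key 0 x Submodule.mem_top hx, fun n x hx ⟨b, hb⟩ => ?_⟩
  have hbc : b ∈ cycles dK n := mem_cycles_of_injective φ hφ (by
    rw [← hb]; exact boundary_mem_cycles hL n x)
  -- As `x` lies over `0`, it is itself a zigzag from `0` to the class of `b`.
  have hb0 : homologyClass dK n ⟨b, hbc⟩ = 0 := by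
    rw [← (hdel n 0 (homologyClass dK n ⟨b, hbc⟩)).2
      ⟨x, 0, ⟨b, hbc⟩, hx, hb, map_zero _, rfl⟩, map_zero]
  obtain ⟨c, hc⟩ := homologyClass_eq_zero.1 hb0
  have hc' : dK n c = b := hc
  obtain ⟨w, b', hw, hb'⟩ := key (n + 1) (x - φ.f (n + 1) c)
    (by change dL n _ = 0; rw [map_sub, hb, ← φ.comm, hc', sub_self])
    (by rw [map_sub, hx, hψφ, sub_zero])
  exact ⟨w, b' + c, hw, by rw [map_add, ← add_assoc, hb', sub_add_cancel]⟩

end Homology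

/-! ### Long exact cohomology sequence and exactness of `ker ψ / im φ`. -/

section Cohomology

variable {𝕜 : Type*} [RCLike 𝕜]
variable {P : ℕ → Type*} [∀ n, NormedAddCommGroup (P n)] [∀ n, NormedSpace 𝕜 (P n)]
variable {Q : ℕ → Type*} [∀ n, NormedAddCommGroup (Q n)] [∀ n, NormedSpace 𝕜 (Q n)]
variable {R : ℕ → Type*} [∀ n, NormedAddCommGroup (R n)] [∀ n, NormedSpace 𝕜 (R n)]
variable {δP : ∀ n, P n →L[𝕜] P (n + 1)} {δQ : ∀ n, Q n →L[𝕜] Q (n + 1)}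
  {δR : ∀ n, R n →L[𝕜] R (n + 1)}

theorem cohomologyClass_surjective (δ : ∀ n, P n →L[𝕜] P (n + 1)) (n : ℕ) :
    Function.Surjective (cohomologyClass δ n) :=
  Submodule.mkQ_surjective _

theorem cohomologyClass_eq_zero {δ : ∀ n, P n →L[𝕜] P (n + 1)} {n : ℕ} {z : cocycles δ n} :
    cohomologyClass δ n z = 0 ↔ (z : P n) ∈ coboundaries δ n :=
  Submodule.Quotient.mk_eq_zero _

theorem cohomologyClass_eq {δ : ∀ n, P n →L[𝕜] P (n + 1)} {n : ℕ} {z z' : cocycles δ n} :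
    cohomologyClass δ n z = cohomologyClass δ n z' ↔ (z - z' : P n) ∈ coboundaries δ n := by
  rw [← sub_eq_zero, ← map_sub, cohomologyClass_eq_zero]
  rfl

theorem mem_cocycles_of_injective (φ : CochainMap δP δQ)
    (hφ : ∀ n, Function.Injective (φ.f n)) {n : ℕ} {x : P n} (h : δQ n (φ.f n x) = 0) :
    x ∈ cocycles δP n := by
  rw [← φ.comm] at h
  exact hφ _ (h.trans (map_zero _).symm)

theorem apply_coboundary {δ : ∀ n, P n →L[𝕜] P (n + 1)} (hδ : ∀ n x, δ (n + 1) (δ n x) = 0) :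
    ∀ {n : ℕ} {x : P n}, x ∈ coboundaries δ n → δ n x = 0
  | 0, x, h => by rw [show x = 0 from h, map_zero]
  | n + 1, _, ⟨w, hw⟩ => by rw [← hw]; exact hδ n w

/-- Lets the chases treat degree `0`, where only `0` is a coboundary, together with the positive
degrees. -/
theorem exists_coboundary_lift (ψ : CochainMap δQ δR) (hψ : ∀ n, Function.Surjective (ψ.f n)) :
    ∀ {n : ℕ} {r : R n}, r ∈ coboundaries δR n → ∃ u ∈ coboundaries δQ n, ψ.f n u = r
  | 0, r, h => ⟨0, Submodule.zero_mem _, by rw [show r = 0 from h, map_zero]⟩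
  | n + 1, _, ⟨w, hw⟩ => by
    obtain ⟨v, rfl⟩ := hψ n w
    exact ⟨δQ n v, ⟨v, rfl⟩, (ψ.comm n v).trans hw⟩

/-- The coboundaries of the subcomplex `ker ψ`. -/
def kerCoboundaries (ψ : CochainMap δQ δR) : ∀ n, Submodule 𝕜 (Q n)
  | 0 => ⊥
  | n + 1 => (LinearMap.ker (ψ.f n).toLinearMap).map (δQ n).toLinearMap

theorem kerCoboundaries_le (ψ : CochainMap δQ δR) :
    ∀ n, kerCoboundaries ψ n ≤ coboundaries δQ n
  | 0 => le_rfl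
  | _ + 1 => LinearMap.map_le_range

/-- The zigzag relation that defines the connecting homomorphism in cohomology. -/
def cozigzag (φ : CochainMap δP δQ) (ψ : CochainMap δQ δR) (n : ℕ) :
    Submodule 𝕜 (Cohomology δR n × Cohomology δP (n + 1)) where
  carrier := {s | ∃ (q : Q n) (r : cocycles δR n) (p : cocycles δP (n + 1)),
      ψ.f n q = r ∧ δQ n q = φ.f (n + 1) p ∧ cohomologyClass δR n r = s.1 ∧
        cohomologyClass δP (n + 1) p = s.2}
  zero_mem' := ⟨0, 0, 0, by simp, by simp, by simp, by simp⟩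
  add_mem' := by
    rintro ⟨_, _⟩ ⟨_, _⟩ ⟨a, z, b, h1, h2, rfl, rfl⟩ ⟨a', z', b', h1', h2', rfl, rfl⟩
    exact ⟨a + a', z + z', b + b', by simp [h1, h1'], by simp [h2, h2'], map_add _ _ _,
      map_add _ _ _⟩
  smul_mem' := by
    rintro c ⟨_, _⟩ ⟨a, z, b, h1, h2, rfl, rfl⟩
    exact ⟨c • a, c • z, c • b, by simp [h1], by simp [h2], map_smul _ _ _, map_smul _ _ _⟩

/-- The subquotient cochain complex `ker ψ / im φ` is exact. -/
def IsCoexactBetween (φ : CochainMap δP δQ) (ψ : CochainMap δQ δR) : Prop :=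
  ∀ n q, ψ.f n q = 0 → (∃ p, δQ n q = φ.f (n + 1) p) →
    ∃ u ∈ kerCoboundaries ψ n, ∃ p, u + φ.f n p = q

/-- The corrected snake chase again, with `kerCoboundaries` supplying the corrections; in degree `0`
there is none. -/
theorem IsCoexactBetween.hasLongExactCohomology {φ : CochainMap δP δQ} {ψ : CochainMap δQ δR}
    (hQ : ∀ n x, δQ (n + 1) (δQ n x) = 0) (hφ : ∀ n, Function.Injective (φ.f n))
    (hψ : ∀ n, Function.Surjective (ψ.f n)) (hψφ : ∀ n x, ψ.f n (φ.f n x) = 0)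
    (h : IsCoexactBetween φ ψ) : HasLongExactCohomology φ ψ := by
  have htotal : ∀ n y, ∃ x, (y, x) ∈ cozigzag φ ψ n := by
    intro n y
    obtain ⟨r, rfl⟩ := cohomologyClass_surjective δR n y
    obtain ⟨q, hq⟩ := hψ n r
    have hr : δR n r = 0 := r.2
    obtain ⟨_, ⟨w, hw, rfl⟩, p, hp⟩ := h (n + 1) (δQ n q) (by rw [ψ.comm, hq, hr])
      ⟨0, by rw [hQ, map_zero]⟩
    have hw' : ψ.f n w = 0 := hw
    have hp' : φ.f (n + 1) p = δQ n (q - w) := by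
      rw [map_sub, ← hp]
      exact (add_sub_cancel_left _ _).symm
    have hpc : p ∈ cocycles δP (n + 1) := mem_cocycles_of_injective φ hφ (by rw [hp', hQ])
    exact ⟨cohomologyClass δP (n + 1) ⟨p, hpc⟩, q - w, r, ⟨p, hpc⟩,
      by rw [map_sub, hq, hw', sub_zero], hp'.symm, rfl, rfl⟩
  have hzero : ∀ n x, (0, x) ∈ cozigzag φ ψ n → x = 0 := by
    rintro n _ ⟨q, r, p, h1, h2, h3, rfl⟩
    obtain ⟨u, hu, hur⟩ := exists_coboundary_lift ψ hψ (cohomologyClass_eq_zero.1 h3)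
    obtain ⟨v, hv, c, hc⟩ := h n (q - u) (by rw [map_sub, h1, hur, sub_self])
      ⟨p, by rw [map_sub, apply_coboundary hQ hu, sub_zero, h2]⟩
    refine cohomologyClass_eq_zero.2 ⟨c, hφ (n + 1) ?_⟩
    have := congrArg (δQ n) hc
    rw [map_add, map_sub, apply_coboundary hQ hu,
      apply_coboundary hQ (kerCoboundaries_le ψ n hv), zero_add, sub_zero, h2] at this
    exact (φ.comm n c).trans this
  choose del hdel using fun n => exists_linearMap_of_relation _ (htotal n) (hzero n)
  refine ⟨del, hdel, ?_, fun n x => ⟨?_, ?_⟩, fun n x => ⟨?_, ?_⟩, fun n y => ⟨?_, ?_⟩⟩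
  · refine (injective_iff_map_eq_zero _).2 fun x hx => ?_
    obtain ⟨p, rfl⟩ := cohomologyClass_surjective δP 0 x
    rw [φ.cohomologyMap_class] at hx
    have hp : φ.f 0 p = 0 := cohomologyClass_eq_zero.1 hx
    exact cohomologyClass_eq_zero.2 (hφ 0 (hp.trans (map_zero _).symm))
  · obtain ⟨q, rfl⟩ := cohomologyClass_surjective δQ n x
    intro hx
    rw [ψ.cohomologyMap_class] at hx
    obtain ⟨u, hu, hur⟩ := exists_coboundary_lift ψ hψ (cohomologyClass_eq_zero.1 hx)
    have hur' : ψ.f n u = ψ.f n q := hur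
    have hq : δQ n q = 0 := q.2
    obtain ⟨v, hv, p, hp⟩ := h n (q - u) (by rw [map_sub, hur', sub_self])
      ⟨0, by rw [map_sub, apply_coboundary hQ hu, hq, map_zero, sub_zero]⟩
    have hv' := kerCoboundaries_le ψ n hv
    have hpc : p ∈ cocycles δP n := mem_cocycles_of_injective φ hφ (by
      rw [eq_sub_of_add_eq' hp, map_sub, map_sub, hq, apply_coboundary hQ hu,
        apply_coboundary hQ hv', sub_zero, sub_zero])
    refine ⟨cohomologyClass δP n ⟨p, hpc⟩, ?_⟩
    rw [φ.cohomologyMap_class, eq_comm, cohomologyClass_eq]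
    change (q - φ.f n p : Q n) ∈ _
    rw [show (q - φ.f n p : Q n) = u + v by rw [eq_sub_of_add_eq' hp]; abel]
    exact Submodule.add_mem _ hu hv'
  · rintro ⟨y, rfl⟩
    obtain ⟨p, rfl⟩ := cohomologyClass_surjective δP n y
    rw [φ.cohomologyMap_class, ψ.cohomologyMap_class]
    refine cohomologyClass_eq_zero.2 ?_
    change ψ.f n (φ.f n p) ∈ _
    rw [hψφ]
    exact Submodule.zero_mem _
  · intro hx
    obtain ⟨q, r, p, h1, h2, rfl, h4⟩ := (hdel n x 0).1 hx
    obtain ⟨c, hc⟩ := cohomologyClass_eq_zero.1 h4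
    have hc' : δP n c = p := hc
    have hqc : q - φ.f n c ∈ cocycles δQ n := by
      change δQ n _ = 0
      rw [map_sub, h2, ← hc', φ.comm, sub_self]
    refine ⟨cohomologyClass δQ n ⟨_, hqc⟩, ?_⟩
    rw [ψ.cohomologyMap_class]
    refine congrArg _ (Subtype.ext ?_)
    change ψ.f n (q - φ.f n c) = r
    rw [map_sub, hψφ, sub_zero, h1]
  · rintro ⟨y, rfl⟩
    obtain ⟨q, rfl⟩ := cohomologyClass_surjective δQ n y
    have hq : δQ n q = 0 := q.2
    exact (hdel n _ 0).2 ⟨q, ψ.cocyclesMap n q, 0, rfl, by simp [hq], rfl, map_zero _⟩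
  · obtain ⟨p, rfl⟩ := cohomologyClass_surjective δP (n + 1) y
    intro hy
    rw [φ.cohomologyMap_class] at hy
    obtain ⟨q, hq⟩ := cohomologyClass_eq_zero.1 hy
    have hq' : δQ n q = φ.f (n + 1) p := hq
    have hr : ψ.f n q ∈ cocycles δR n := by
      change δR n _ = 0
      rw [← ψ.comm, hq', hψφ]
    exact ⟨cohomologyClass δR n ⟨_, hr⟩, (hdel n _ _).2 ⟨q, ⟨_, hr⟩, p, rfl, hq', rfl, rfl⟩⟩
  · rintro ⟨x, rfl⟩
    obtain ⟨q, r, p, -, h2, -, h4⟩ := (hdel n x _).1 rfl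
    have h4' : cohomologyClass δP (n + 1) p = del n x := h4
    rw [← h4', φ.cohomologyMap_class]
    exact cohomologyClass_eq_zero.2 ⟨q, h2⟩

theorem HasLongExactCohomology.isCoexactBetween {φ : CochainMap δP δQ} {ψ : CochainMap δQ δR}
    (hQ : ∀ n x, δQ (n + 1) (δQ n x) = 0) (hφ : ∀ n, Function.Injective (φ.f n))
    (hψ : ∀ n, Function.Surjective (ψ.f n)) (hψφ : ∀ n x, ψ.f n (φ.f n x) = 0)
    (h : HasLongExactCohomology φ ψ) : IsCoexactBetween φ ψ := by
  obtain ⟨del, hdel, -, hex, -, -⟩ := h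
  have key : ∀ (n : ℕ) (q : Q n), δQ n q = 0 → ψ.f n q = 0 →
      ∃ u ∈ kerCoboundaries ψ n, ∃ p, u + φ.f n p = q := by
    intro n q hqc hq
    obtain ⟨y, hy⟩ := (hex n (cohomologyClass δQ n ⟨q, hqc⟩)).1 (by
      rw [ψ.cohomologyMap_class]
      refine cohomologyClass_eq_zero.2 ?_
      change ψ.f n q ∈ _
      rw [hq]
      exact Submodule.zero_mem _)
    obtain ⟨c, rfl⟩ := cohomologyClass_surjective δP n y
    rw [φ.cohomologyMap_class, eq_comm, cohomologyClass_eq] at hy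
    have hy' : q - φ.f n c ∈ coboundaries δQ n := hy
    -- In degree `0` the class identity is already an equality of cochains. In positive degree the
    -- primitive `l` must be moved into `ker ψ` by a zigzag for the class of `ψ l`.
    cases n with
    | zero => exact ⟨_, hy', c, sub_add_cancel _ _⟩
    | succ n =>
      obtain ⟨l, hl⟩ := hy'
      have hl' : δQ n l = q - φ.f (n + 1) c := hl
      have hr : ψ.f n l ∈ cocycles δR n := by
        change δR n _ = 0
        rw [← ψ.comm, hl', map_sub, hq, hψφ, sub_zero]
      obtain ⟨a, r, p, h1, h2, h3, -⟩ :=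
        (hdel n (cohomologyClass δR n ⟨_, hr⟩) _).1 rfl
      obtain ⟨u, hu, hur⟩ := exists_coboundary_lift ψ hψ (cohomologyClass_eq.1 h3)
      refine ⟨_, ⟨l - a + u, ?_, rfl⟩, c + p, ?_⟩
      · change ψ.f n (l - a + u) = 0
        rw [map_add, map_sub, hur, h1]
        abel
      · change δQ n (l - a + u) + _ = q
        rw [map_add, map_sub, apply_coboundary hQ hu, hl', h2, map_add]
        abel
  intro n q hq ⟨p, hp⟩
  have hpc : p ∈ cocycles δP (n + 1) := mem_cocycles_of_injective φ hφ (by rw [← hp, hQ])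
  have hp0 : cohomologyClass δP (n + 1) ⟨p, hpc⟩ = 0 := by
    rw [← (hdel n 0 (cohomologyClass δP (n + 1) ⟨p, hpc⟩)).2
      ⟨q, 0, ⟨p, hpc⟩, hq, hp, map_zero _, rfl⟩, map_zero]
  obtain ⟨c, hc⟩ := cohomologyClass_eq_zero.1 hp0
  have hc' : δP n c = p := hc
  obtain ⟨u, hu, b, hb⟩ := key n (q - φ.f n c)
    (by rw [map_sub, hp, ← φ.comm, hc', sub_self])
    (by rw [map_sub, hq, hψφ, sub_zero])
  exact ⟨u, hu, b + c, by rw [map_add, ← add_assoc, hb, sub_add_cancel]⟩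

end Cohomology

/-! ### The dual of `ker ψ / im φ`. -/

section DualSubquotient

variable {𝕜 : Type*} [RCLike 𝕜]
variable {K : ℕ → Type*} [∀ n, NormedAddCommGroup (K n)] [∀ n, NormedSpace 𝕜 (K n)]
variable {L : ℕ → Type*} [∀ n, NormedAddCommGroup (L n)] [∀ n, NormedSpace 𝕜 (L n)]
variable {M : ℕ → Type*} [∀ n, NormedAddCommGroup (M n)] [∀ n, NormedSpace 𝕜 (M n)]
variable {dK : ∀ n, K (n + 1) →L[𝕜] K n} {dL : ∀ n, L (n + 1) →L[𝕜] L n}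
  {dM : ∀ n, M (n + 1) →L[𝕜] M n}

/-- The kernel of a chain map. -/
abbrev ChainMap.ker (ψ : ChainMap dL dM) (n : ℕ) : Submodule 𝕜 (L n) :=
  LinearMap.ker (ψ.f n).toLinearMap

/-- The differential of the kernel of a chain map. -/
def ChainMap.kerD (ψ : ChainMap dL dM) (n : ℕ) : ψ.ker (n + 1) →L[𝕜] ψ.ker n :=
  ((dL n).comp (ψ.ker (n + 1)).subtypeL).codRestrict _ fun x => by
    have hx : ψ.f (n + 1) x = 0 := x.2
    change ψ.f n (dL n x) = 0
    rw [ψ.comm, hx, map_zero]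

theorem ChainMap.coe_kerD (ψ : ChainMap dL dM) (n : ℕ) (x : ψ.ker (n + 1)) :
    (ψ.kerD n x : L n) = dL n x := rfl

/-- A presentation of the complex `ker ψ / im φ` by a complex of normed spaces. -/
structure IsSubquotient (φ : ChainMap dK dL) (ψ : ChainMap dL dM)
    {X : ℕ → Type*} [∀ n, NormedAddCommGroup (X n)] [∀ n, NormedSpace 𝕜 (X n)]
    (e : ∀ n, X (n + 1) →L[𝕜] X n) (π : ∀ n, ψ.ker n →L[𝕜] X n) : Prop where
  surjective : ∀ n, Function.Surjective (π n)
  eq_zero_iff : ∀ n x, π n x = 0 ↔ ∃ b, φ.f n b = x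
  comm : ∀ n x, e n (π (n + 1) x) = π n (ψ.kerD n x)

variable {φ : ChainMap dK dL} {ψ : ChainMap dL dM}
  {X : ℕ → Type*} [∀ n, NormedAddCommGroup (X n)] [∀ n, NormedSpace 𝕜 (X n)]
  {e : ∀ n, X (n + 1) →L[𝕜] X n} {π : ∀ n, ψ.ker n →L[𝕜] X n}

theorem IsSubquotient.isExactBetween_iff (h : IsSubquotient φ ψ e π) :
    IsExactBetween φ ψ ↔ IsExactComplex e := by
  have heq : ∀ n (x y : ψ.ker n), π n x = π n y ↔ ∃ b, φ.f n b = (x - y : L n) := fun n x y => by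
    rw [← sub_eq_zero, ← map_sub, h.eq_zero_iff]
    rfl
  constructor
  · rintro ⟨h0, h1⟩
    refine ⟨fun ξ => ?_, fun n ξ hξ => ?_⟩
    · obtain ⟨x, rfl⟩ := h.surjective 0 ξ
      obtain ⟨w, b, hw, hb⟩ := h0 x x.2
      refine ⟨π 1 ⟨w, hw⟩, ?_⟩
      rw [h.comm, eq_comm, heq]
      exact ⟨b, eq_sub_of_add_eq' hb⟩
    · obtain ⟨x, rfl⟩ := h.surjective (n + 1) ξ
      rw [h.comm, h.eq_zero_iff] at hξ
      obtain ⟨c, hc⟩ := hξ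
      obtain ⟨w, b, hw, hb⟩ := h1 n x x.2 ⟨c, hc.symm⟩
      refine ⟨π (n + 2) ⟨w, hw⟩, ?_⟩
      rw [h.comm, eq_comm, heq]
      exact ⟨b, eq_sub_of_add_eq' hb⟩
  · rintro ⟨h0, h1⟩
    refine ⟨fun x hx => ?_, fun n x hx hd => ?_⟩
    · obtain ⟨ξ, hξ⟩ := h0 (π 0 ⟨x, hx⟩)
      obtain ⟨w, rfl⟩ := h.surjective 1 ξ
      rw [h.comm, eq_comm, heq] at hξ
      obtain ⟨b, hb⟩ := hξ
      exact ⟨w, b, w.2, add_eq_of_eq_sub' hb⟩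
    · obtain ⟨c, hc⟩ := hd
      obtain ⟨ξ, hξ⟩ := h1 n (π (n + 1) ⟨x, hx⟩) (by
        rw [h.comm, h.eq_zero_iff]
        exact ⟨c, hc.symm⟩)
      obtain ⟨w, rfl⟩ := h.surjective (n + 2) ξ
      rw [h.comm, eq_comm, heq] at hξ
      obtain ⟨b, hb⟩ := hξ
      exact ⟨w, b, w.2, add_eq_of_eq_sub' hb⟩

/-- A functional on `X n` is a functional on `ker ψ` that kills `im φ`. By Hahn-Banach it is the
restriction of a functional on `L n` killing `im φ`, unique up to the annihilator of `ker ψ`, which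
is the range of the dual of `ψ`. -/
theorem IsSubquotient.isCoexactBetween_dual_iff [∀ n, CompleteSpace (L n)]
    [∀ n, CompleteSpace (M n)] [∀ n, CompleteSpace (X n)]
    (h : IsSubquotient φ ψ e π) (hψ : ∀ n, Function.Surjective (ψ.f n))
    (hψφ : ∀ n x, ψ.f n (φ.f n x) = 0) :
    IsCoexactBetween ψ.dual φ.dual ↔ IsDualExactComplex e := by
  have hker : ∀ n, CompleteSpace (ψ.ker n) := fun n =>
    (ψ.f n).isClosed_ker.completeSpace_coe
  have hann : ∀ n (g : StrongDual 𝕜 (L n)), (∀ x : ψ.ker n, g x = 0) →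
      ∃ p, dualOp (ψ.f n) p = g := fun n g hg =>
    exists_dualOp_eq_of_ker_le (ψ.f n) (by rw [(hψ n).range_eq]; exact isClosed_univ) g
      fun y hy => hg ⟨y, hy⟩
  have hdown : ∀ n (g : StrongDual 𝕜 (L n)), dualOp (φ.f n) g = 0 →
      ∃ f : StrongDual 𝕜 (X n), ∀ x, f (π n x) = g x := by
    intro n g hg
    obtain ⟨f, hf⟩ := exists_dualOp_eq_of_ker_le (π n)
      (by rw [(h.surjective n).range_eq]; exact isClosed_univ) (g.comp (ψ.ker n).subtypeL) (by
        intro y hy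
        obtain ⟨b, hb⟩ := (h.eq_zero_iff n y).1 hy
        change g y = 0
        rw [← hb]
        exact DFunLike.congr_fun hg b)
    exact ⟨f, fun x => DFunLike.congr_fun hf x⟩
  have hup : ∀ n (f : StrongDual 𝕜 (X n)), ∃ g : StrongDual 𝕜 (L n),
      dualOp (φ.f n) g = 0 ∧ ∀ x, f (π n x) = g x := by
    intro n f
    obtain ⟨g, hg, -⟩ := exists_extension_norm_eq (ψ.ker n) (f.comp (π n))
    refine ⟨g, ContinuousLinearMap.ext fun b => ?_, fun x => (hg x).symm⟩
    have := hg ⟨φ.f n b, hψφ n b⟩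
    rw [ContinuousLinearMap.comp_apply, (h.eq_zero_iff n _).2 ⟨b, rfl⟩, map_zero] at this
    exact this
  have hψ0 : ∀ n (p : StrongDual 𝕜 (M n)) (x : ψ.ker n), dualOp (ψ.f n) p x = 0 := fun n p x => by
    rw [dualOp_apply, show ψ.f n x = 0 from x.2, map_zero]
  constructor
  · intro H
    have lift : ∀ n (f : StrongDual 𝕜 (X n)), dualOp (e n) f = 0 →
        ∃ u ∈ kerCoboundaries φ.dual n, ∀ x, f (π n x) = u x := by
      intro n f hf
      obtain ⟨g, hg, hfg⟩ := hup n f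
      -- That `f` is a cocycle says only that the coboundary of its extension `g` vanishes on `ker
      -- ψ`, which is the cocycle condition modulo the range of the dual of `ψ`.
      obtain ⟨p, hp⟩ := hann (n + 1) (dualOp (dL n) g) fun x => by
        rw [dualOp_apply, ← ψ.coe_kerD, ← hfg, ← h.comm]
        exact DFunLike.congr_fun hf _
      obtain ⟨u, hu, p', hp'⟩ := H n g hg ⟨p, hp.symm⟩
      refine ⟨u, hu, fun x => ?_⟩
      rw [hfg, ← hp', add_apply]
      exact (congrArg _ (hψ0 n p' x)).trans (add_zero _)
    refine ⟨(injective_iff_map_eq_zero _).2 fun f hf => ?_, fun n f hf => ?_⟩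
    · obtain ⟨u, hu, hfu⟩ := lift 0 f hf
      have hu0 : u = 0 := hu
      ext ξ
      obtain ⟨x, rfl⟩ := h.surjective 0 ξ
      rw [hfu, hu0]
      rfl
    · obtain ⟨_, ⟨w, hw, rfl⟩, hfu⟩ := lift (n + 1) f hf
      obtain ⟨q, hq⟩ := hdown n w hw
      refine ⟨q, ContinuousLinearMap.ext fun ξ => ?_⟩
      obtain ⟨x, rfl⟩ := h.surjective (n + 1) ξ
      rw [hfu, dualOp_apply, h.comm, hq]
      rfl
  · intro ⟨hinj, hex⟩ n g hg ⟨p, hp⟩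
    obtain ⟨f, hf⟩ := hdown n g hg
    have hf0 : dualOp (e n) f = 0 := by
      ext ξ
      obtain ⟨x, rfl⟩ := h.surjective (n + 1) ξ
      rw [dualOp_apply, h.comm, hf]
      exact (DFunLike.congr_fun hp (x : L (n + 1))).trans (hψ0 (n + 1) p x)
    have finish : ∀ u ∈ kerCoboundaries φ.dual n, (∀ x, f (π n x) = u x) →
        ∃ u ∈ kerCoboundaries φ.dual n, ∃ p, u + ψ.dual.f n p = g := by
      intro u hu hfu
      obtain ⟨p', hp'⟩ := hann n (g - u) fun x => by rw [sub_apply, ← hf, hfu, sub_self]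
      exact ⟨u, hu, p', add_eq_of_eq_sub' hp'⟩
    cases n with
    | zero =>
      have : f = 0 := (injective_iff_map_eq_zero _).1 hinj f hf0
      exact finish 0 (Submodule.zero_mem _) fun x => by rw [this]; rfl
    | succ n =>
      obtain ⟨q, rfl⟩ := hex n f hf0
      obtain ⟨w, hw, hqw⟩ := hup n q
      refine finish (dualOp (dL n) w) ⟨w, hw, rfl⟩ fun x => ?_
      rw [dualOp_apply, dualOp_apply, h.comm, hqw]
      rfl

/-- If `φ` has a surjective dual and `ψ` is surjective, then the complex `ker ψ / im φ` is exact
if and only if the corresponding subquotient of the dual complexes is exact. -/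
theorem isExactBetween_iff_isCoexactBetween_dual [∀ n, CompleteSpace (K n)]
    [∀ n, CompleteSpace (L n)] [∀ n, CompleteSpace (M n)] (φ : ChainMap dK dL)
    (ψ : ChainMap dL dM) (hL : ∀ n x, dL n (dL (n + 1) x) = 0)
    (hφ : ∀ n, Function.Surjective (dualOp (φ.f n)))
    (hψ : ∀ n, Function.Surjective (ψ.f n)) (hψφ : ∀ n x, ψ.f n (φ.f n x) = 0) :
    IsExactBetween φ ψ ↔ IsCoexactBetween ψ.dual φ.dual := by
  let R : ∀ n, Submodule 𝕜 (ψ.ker n) := fun n =>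
    (LinearMap.range (φ.f n).toLinearMap).submoduleOf (ψ.ker n)
  have hker : ∀ n, CompleteSpace (ψ.ker n) := fun n =>
    (ψ.f n).isClosed_ker.completeSpace_coe
  -- Closedness of `im φ` makes the quotient a Banach space; it holds because `φ` is bounded below
  -- on a complete space.
  have hR : ∀ n, IsClosed (R n : Set (ψ.ker n)) := fun n => by
    obtain ⟨C, hC⟩ := antilipschitz_of_surjective_dual (φ.f n) (hφ n)
    exact (hC.isClosed_range (φ.f n).uniformContinuous).preimage continuous_subtype_val
  let e : ∀ n, (ψ.ker (n + 1) ⧸ R (n + 1)) →L[𝕜] (ψ.ker n ⧸ R n) := fun n =>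
    (R (n + 1)).liftQL ((R n).mkQL.comp (ψ.kerD n)) (by
      rintro ⟨_, hx⟩ ⟨b, rfl⟩
      exact (Submodule.Quotient.mk_eq_zero _).2 ⟨dK n b, φ.comm n b⟩)
  have he : ∀ n x, e n ((R (n + 1)).mkQL x) = (R n).mkQL (ψ.kerD n x) := fun n x => rfl
  have hsub : IsSubquotient φ ψ e fun n => (R n).mkQL :=
    { surjective := fun n => Submodule.mkQ_surjective _
      eq_zero_iff := fun n x => Submodule.Quotient.mk_eq_zero _
      comm := he }
  have hee : ∀ n x, e n (e (n + 1) x) = 0 := fun n x => by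
    obtain ⟨x, rfl⟩ := Submodule.mkQ_surjective _ x
    change (R n).mkQL (ψ.kerD n (ψ.kerD (n + 1) x)) = 0
    rw [show ψ.kerD n (ψ.kerD (n + 1) x) = 0 from Subtype.ext (hL n x), map_zero]
  rw [hsub.isExactBetween_iff, hsub.isCoexactBetween_dual_iff hψ hψφ]
  exact isExactComplex_iff_dual (X := fun n => ψ.ker n ⧸ R n) e hee

/-- For a short sequence of complexes of Banach spaces that is exact except possibly in the middle,
and whose dual is exact at its ends, the long homology sequence is exact if and only if
the long cohomology sequence of the dual complexes is. -/
theorem hasLongExactHomology_iff_hasLongExactCohomology_dual [∀ n, CompleteSpace (K n)]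
    [∀ n, CompleteSpace (L n)] [∀ n, CompleteSpace (M n)] (φ : ChainMap dK dL)
    (ψ : ChainMap dL dM) (hL : ∀ n x, dL n (dL (n + 1) x) = 0)
    (hφ : ∀ n, Function.Surjective (dualOp (φ.f n)))
    (hψ : ∀ n, Function.Surjective (ψ.f n)) (hψφ : ∀ n x, ψ.f n (φ.f n x) = 0) :
    HasLongExactHomology φ ψ ↔ HasLongExactCohomology ψ.dual φ.dual := by
  have hφinj : ∀ n, Function.Injective (φ.f n) := fun n =>
    (antilipschitz_of_surjective_dual (φ.f n) (hφ n)).choose_spec.injective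
  have hψinj : ∀ n, Function.Injective (ψ.dual.f n) := fun n f g hfg => by
    ext x
    obtain ⟨y, rfl⟩ := hψ n x
    exact DFunLike.congr_fun hfg y
  have hL' : ∀ n g, dualDifferential dL (n + 1) (dualDifferential dL n g) = 0 := fun n g => by
    ext x
    exact (congrArg g (hL n x)).trans (map_zero g)
  have hφψ : ∀ n f, φ.dual.f n (ψ.dual.f n f) = 0 := fun n f => by
    ext x
    exact (congrArg f (hψφ n x)).trans (map_zero f)
  have key := isExactBetween_iff_isCoexactBetween_dual φ ψ hL hφ hψ hψφ
  exact ⟨fun h => (key.1 (h.isExactBetween hL hφinj hψ hψφ)).hasLongExactCohomology hL' hψinj hφ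
      hφψ,
    fun h => (key.2 (h.isCoexactBetween hL' hψinj hφ hφψ)).hasLongExactHomology hL hφinj hψ hψφ⟩

end DualSubquotient

/-! ### The differentials square to zero. -/

section Cancellation

/-- The double alternating sum of a family satisfying the relations between faces vanishes. -/
theorem alternating_sum_sum_eq_zero {R V : Type*} [CommRing R] [AddCommGroup V] [Module R V]
    (N : ℕ) (F : ℕ → ℕ → V) (hF : ∀ i j, i ≤ j → j < N → F i (j + 1) = F j i) :
    ∑ i ∈ Finset.range N, ∑ j ∈ Finset.range (N + 1),
      ((-1 : R) ^ j * (-1 : R) ^ i) • F i j = 0 := by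
  rw [← Finset.sum_product', ← Finset.sum_filter_add_sum_filter_not _ (fun p => p.2 ≤ p.1),
    ← eq_neg_iff_add_eq_zero, ← Finset.sum_neg_distrib]
  -- The face relation matches the term at `(i, j)`, `j ≤ i`, with the one at `(j, i + 1)`; the
  -- index shift by one flips the sign.
  refine Finset.sum_bij' (fun p _ => (p.2, p.1 + 1)) (fun p _ => (p.2 - 1, p.1)) ?_ ?_ ?_ ?_ ?_
  · rintro ⟨i, j⟩ h
    simp only [Finset.mem_filter, Finset.mem_product, Finset.mem_range] at h ⊢
    omega
  · rintro ⟨i, j⟩ h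
    simp only [Finset.mem_filter, Finset.mem_product, Finset.mem_range] at h ⊢
    omega
  · rintro ⟨i, j⟩ h
    simp
  · rintro ⟨i, j⟩ h
    simp only [Finset.mem_filter, Finset.mem_product, Finset.mem_range] at h
    simp only [Prod.mk.injEq, true_and]
    omega
  · rintro ⟨i, j⟩ h
    simp only [Finset.mem_filter, Finset.mem_product, Finset.mem_range] at h
    dsimp only
    rw [hF j i h.2 h.1.1, ← neg_smul]
    congr 1
    ring

end Cancellation

section Faces

variable {A : Type*} [NonUnitalNormedRing A]

/-- Reduces identities between tuples to arithmetic of natural indices, free of bound proofs; the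
value `0` beyond `n` is never read. -/
theorem exists_eq_comp_val {α : Type*} [Zero α] {n : ℕ} (a : Fin n → α) :
    ∃ f : ℕ → α, a = fun k : Fin n => f k :=
  ⟨fun m => if h : m < n then a ⟨m, h⟩ else 0, by ext k; simp⟩

theorem innerFace_innerFace {n i j : ℕ} (hij : i ≤ j) (hj : j < n + 1)
    (a : Fin (n + 3) → A) :
    innerFace A ⟨i, by omega⟩ (innerFace A ⟨j + 1, by omega⟩ a) =
      innerFace A ⟨j, hj⟩ (innerFace A ⟨i, by omega⟩ a) := by
  obtain ⟨a, rfl⟩ := exists_eq_comp_val a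
  funext k
  obtain ⟨k, hk⟩ := k
  simp only [innerFace, Fin.contractNth, Fin.val_castSucc, Fin.val_succ]
  grind [mul_assoc]

theorem innerFace_cyclicFace {n i : ℕ} (hi : i < n + 1) (a : Fin (n + 3) → A) :
    innerFace A ⟨i, hi⟩ (cyclicFace A a) = cyclicFace A (innerFace A ⟨i, by omega⟩ a) := by
  obtain ⟨a, rfl⟩ := exists_eq_comp_val a
  funext k
  obtain ⟨k, hk⟩ := k
  simp only [innerFace, cyclicFace, Fin.contractNth, Fin.val_castSucc, Fin.val_succ, Fin.init,
    Function.update_apply, Fin.ext_iff, Fin.val_zero, Fin.val_last]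
  grind [mul_assoc]

theorem cyclicFace_cyclicFace {n : ℕ} (a : Fin (n + 3) → A) :
    cyclicFace A (cyclicFace A a) = cyclicFace A (innerFace A ⟨n + 1, by omega⟩ a) := by
  obtain ⟨a, rfl⟩ := exists_eq_comp_val a
  funext k
  obtain ⟨k, hk⟩ := k
  simp only [innerFace, cyclicFace, Fin.contractNth, Fin.val_castSucc, Fin.val_succ, Fin.init,
    Function.update_apply, Fin.ext_iff, Fin.val_zero, Fin.val_last]
  grind [mul_assoc]

/-- The `j`-th face of an `(n + 2)`-tuple: inner for `j ≤ n`, and cyclic for `j = n + 1`. -/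
def face {n : ℕ} (j : ℕ) (a : Fin (n + 2) → A) : Fin (n + 1) → A :=
  if h : j < n + 1 then innerFace A ⟨j, h⟩ a else cyclicFace A a

theorem face_face {n i j : ℕ} (hij : i ≤ j) (hj : j < n + 2) (a : Fin (n + 3) → A) :
    face i (face (j + 1) a) = face j (face i a) := by
  unfold face
  rcases Nat.lt_or_ge j (n + 1) with h | h
  · rw [dif_pos (show j + 1 < n + 2 by omega), dif_pos (show i < n + 1 by omega),
      dif_pos (show i < n + 2 by omega), dif_pos h]
    exact innerFace_innerFace hij h a
  · obtain rfl : j = n + 1 := by omega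
    rw [dif_neg (show ¬ n + 1 + 1 < n + 1 + 1 by omega), dif_neg (show ¬ n + 1 < n + 1 by omega),
      dif_pos (show i < n + 2 by omega)]
    rcases Nat.lt_or_ge i (n + 1) with h' | h'
    · rw [dif_pos h']
      exact innerFace_cyclicFace h' a
    · obtain rfl : i = n + 1 := by omega
      rw [dif_neg (show ¬ n + 1 < n + 1 by omega)]
      exact cyclicFace_cyclicFace a

end Faces

section Differentials

variable {𝕜 : Type*} [RCLike 𝕜]
variable {A : Type*} [NonUnitalNormedRing A] [NormedSpace 𝕜 A] [IsScalarTower 𝕜 A A]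
  [SMulCommClass 𝕜 A A]

theorem barD_pureTensor_eq_sum_range {n : ℕ} (a : Fin (n + 2) → A) :
    barD 𝕜 A n (pureTensor 𝕜 a) =
      ∑ j ∈ Finset.range (n + 1), (-1 : 𝕜) ^ j • pureTensor 𝕜 (face j a) := by
  rw [barD_pureTensor, Finset.sum_range]
  refine Finset.sum_congr rfl fun j _ => ?_
  rw [face, dif_pos j.isLt]

theorem simplicialD_pureTensor_eq_sum_range {n : ℕ} (a : Fin (n + 2) → A) :
    simplicialD 𝕜 A n (pureTensor 𝕜 a) =
      ∑ j ∈ Finset.range (n + 2), (-1 : 𝕜) ^ j • pureTensor 𝕜 (face j a) := by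
  rw [Finset.sum_range_succ, ← barD_pureTensor_eq_sum_range, simplicialD_pureTensor,
    barD_pureTensor, face, dif_neg (lt_irrefl _)]

/-- The face relations never raise an index beyond the truncation, so one cancellation serves both
complexes: `N = n + 1` keeps the inner faces (bar), `N = n + 2` adds the cyclic one (simplicial). -/
theorem sum_face_face_eq_zero {n N : ℕ} (hN : N ≤ n + 2) (a : Fin (n + 3) → A) :
    ∑ j ∈ Finset.range (N + 1), (-1 : 𝕜) ^ j •
      ∑ i ∈ Finset.range N, (-1 : 𝕜) ^ i • pureTensor 𝕜 (face i (face j a)) = 0 := by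
  simp only [Finset.smul_sum, smul_smul]
  rw [Finset.sum_comm]
  exact alternating_sum_sum_eq_zero N (fun i j => pureTensor 𝕜 (face i (face j a)))
    fun i j hij hj => congrArg _ (face_face hij (by omega) a)

theorem barD_barD (n : ℕ) (x : Chains 𝕜 A (n + 2)) : barD 𝕜 A n (barD 𝕜 A (n + 1) x) = 0 := by
  have : barD 𝕜 A n ∘L barD 𝕜 A (n + 1) = 0 := chains_ext fun a => by
    rw [ContinuousLinearMap.comp_apply, barD_pureTensor_eq_sum_range, map_sum]
    simp only [map_smul, barD_pureTensor_eq_sum_range]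
    exact sum_face_face_eq_zero (by omega) a
  exact DFunLike.congr_fun this x

theorem simplicialD_simplicialD (n : ℕ) (x : Chains 𝕜 A (n + 2)) :
    simplicialD 𝕜 A n (simplicialD 𝕜 A (n + 1) x) = 0 := by
  have : simplicialD 𝕜 A n ∘L simplicialD 𝕜 A (n + 1) = 0 := chains_ext fun a => by
    rw [ContinuousLinearMap.comp_apply, simplicialD_pureTensor_eq_sum_range, map_sum]
    simp only [map_smul, simplicialD_pureTensor_eq_sum_range]
    exact sum_face_face_eq_zero le_rfl a
  exact DFunLike.congr_fun this x

end Differentials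

/-! ### Projective tensor powers of `i` and `j`. -/

section TensorPowers

variable {𝕜 : Type*} [RCLike 𝕜]
variable {B : Type*} [NormedAddCommGroup B] [NormedSpace 𝕜 B]
variable {A : Type*} [NormedAddCommGroup A] [NormedSpace 𝕜 A]

/-- If the dual of `i : B → A` has a continuous linear right inverse, then bounded multilinear
forms on `B` extend along `i` to `A`, in a continuous linear way. -/
theorem exists_extension_multilinear (i : B →L[𝕜] A) (s : StrongDual 𝕜 B →L[𝕜] StrongDual 𝕜 A)
    (hs : ∀ f, dualOp i (s f) = f) (n : ℕ) :
    ∃ σ : ContinuousMultilinearMap 𝕜 (fun _ : Fin n => B) 𝕜 →L[𝕜]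
        ContinuousMultilinearMap 𝕜 (fun _ : Fin n => A) 𝕜,
      ∀ G b, σ G (fun k => i (b k)) = G b := by
  induction n with
  | zero =>
    let e : ContinuousMultilinearMap 𝕜 (fun _ : Fin 0 => B) 𝕜 ≃L[𝕜] 𝕜 :=
      (continuousMultilinearCurryFin0 𝕜 B 𝕜).toContinuousLinearEquiv
    let e' : ContinuousMultilinearMap 𝕜 (fun _ : Fin 0 => A) 𝕜 ≃L[𝕜] 𝕜 :=
      (continuousMultilinearCurryFin0 𝕜 A 𝕜).toContinuousLinearEquiv
    refine ⟨e'.symm.toContinuousLinearMap.comp e.toContinuousLinearMap, fun G b => ?_⟩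
    rw [Subsingleton.elim b 0]
    rfl
  | succ n ih =>
    obtain ⟨σ, hσ⟩ := ih
    let c := (continuousMultilinearCurryLeftEquiv 𝕜 (fun _ : Fin (n + 1) => B)
      𝕜).toContinuousLinearEquiv.toContinuousLinearMap
    let c' := (continuousMultilinearCurryLeftEquiv 𝕜 (fun _ : Fin (n + 1) => A)
      𝕜).symm.toContinuousLinearEquiv.toContinuousLinearMap
    let p := ContinuousLinearMap.compL 𝕜 B
      (ContinuousMultilinearMap 𝕜 (fun _ : Fin n => B) 𝕜)
      (ContinuousMultilinearMap 𝕜 (fun _ : Fin n => A) 𝕜) σ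
    let fl := (ContinuousLinearMap.flipMultilinearEquiv 𝕜 (fun _ : Fin n => A) B
      𝕜).toContinuousLinearMap
    let q := ContinuousLinearMap.compContinuousMultilinearMapL 𝕜 (fun _ : Fin n => A)
      (StrongDual 𝕜 B) (StrongDual 𝕜 A) s
    let fl' := (ContinuousLinearMap.flipMultilinearEquiv 𝕜 (fun _ : Fin n => A) A
      𝕜).symm.toContinuousLinearMap
    -- Curry off the first variable, extend the other `n` by `σ`, flip so that the form takes values
    -- in the dual of `B`, extend these values by `s`, then flip back and uncurry.
    refine ⟨c' ∘L fl' ∘L q ∘L fl ∘L p ∘L c, fun G b => ?_⟩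
    change s ((fl (p (c G))) fun k : Fin n => i (b k.succ)) (i (b 0)) = G b
    rw [← dualOp_apply, hs]
    change σ (c G (b 0)) (fun k : Fin n => i (b k.succ)) = G b
    rw [hσ]
    change G (Fin.cons (b 0) (Fin.tail b)) = G b
    rw [Fin.cons_self_tail]

theorem norm_pureTensor_le {n : ℕ} (a : Fin (n + 1) → A) :
    ‖pureTensor 𝕜 a‖ ≤ ∏ k, ‖a k‖ := by
  unfold pureTensor
  rw [UniformSpace.Completion.norm_coe]
  exact PiTensorProduct.projectiveSeminorm_tprod_le a

/-- A functional on `C_n(A)` is bounded by its bound on elementary tensors. -/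
theorem opNorm_le_of_pureTensor {n : ℕ} (f : StrongDual 𝕜 (Chains 𝕜 A n)) {C : ℝ} (hC : 0 ≤ C)
    (h : ∀ a, ‖f (pureTensor 𝕜 a)‖ ≤ C * ∏ k, ‖a k‖) : ‖f‖ ≤ C := by
  let G : (⨂[𝕜] _ : Fin (n + 1), A) →L[𝕜] 𝕜 :=
    f.comp (UniformSpace.Completion.toComplL (𝕜 := 𝕜))
  have hG : ‖G‖ ≤ C := by
    -- For the projective norm, functionals are isometrically the bounded multilinear forms, whose
    -- norm is read off elementary tensors.
    rw [← (PiTensorProduct.liftIsometry 𝕜 (fun _ : Fin (n + 1) => A) 𝕜).symm.norm_map G]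
    exact ContinuousMultilinearMap.opNorm_le_bound hC h
  refine f.opNorm_le_bound hC fun x => ?_
  induction x using UniformSpace.Completion.induction_on with
  | hp => exact isClosed_le f.continuous.norm (continuous_const.mul continuous_norm)
  | ih x =>
    rw [UniformSpace.Completion.norm_coe]
    exact (G.le_opNorm x).trans (by gcongr)

/-- If the dual of `i` has a continuous linear right inverse, then the dual of `i ⊗ ⋯ ⊗ i` is
surjective. -/
theorem surjective_dualOp_chainsMap (i : B →L[𝕜] A) (s : StrongDual 𝕜 B →L[𝕜] StrongDual 𝕜 A)
    (hs : ∀ f, dualOp i (s f) = f) (n : ℕ) : Function.Surjective (dualOp (chainsMap i n)) := by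
  intro f
  obtain ⟨σ, hσ⟩ := exists_extension_multilinear i s hs (n + 1)
  let G := (PiTensorProduct.liftIsometry 𝕜 (fun _ : Fin (n + 1) => B) 𝕜).symm
    (f.comp (UniformSpace.Completion.toComplL (𝕜 := 𝕜)))
  refine ⟨(PiTensorProduct.liftIsometry 𝕜 _ 𝕜 (σ G)).fromCompletion, chains_ext fun b => ?_⟩
  rw [dualOp_apply, chainsMap_pureTensor]
  unfold pureTensor
  rw [ContinuousLinearMap.fromCompletion_apply_coe, PiTensorProduct.liftIsometry_apply_apply,
    PiTensorProduct.lift.tprod]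
  exact hσ G b

/-- Projective tensor powers of surjective operators between Banach spaces are surjective. -/
theorem surjective_chainsMap [CompleteSpace B] [CompleteSpace A] (j : B →L[𝕜] A)
    (hj : Function.Surjective j) (n : ℕ) : Function.Surjective (chainsMap j n) := by
  obtain ⟨C, hC, hpre⟩ := j.exists_preimage_norm_le hj
  choose p hp hpn using hpre
  -- Each of the `n + 1` factors of an elementary tensor is lifted at cost `C`, whence the constant
  -- `C ^ (n + 1)` in the lower bound for the dual.
  refine surjective_of_norm_le_dual (chainsMap j n) (pow_pos hC (n + 1)) fun f => ?_
  refine opNorm_le_of_pureTensor f (by positivity) fun a => ?_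
  have ha : pureTensor 𝕜 a = chainsMap j n (pureTensor 𝕜 (p ∘ a)) := by
    rw [chainsMap_pureTensor]
    exact congrArg _ (funext fun k => (hp (a k)).symm)
  rw [ha, ← dualOp_apply]
  calc ‖dualOp (chainsMap j n) f (pureTensor 𝕜 (p ∘ a))‖
      ≤ ‖dualOp (chainsMap j n) f‖ * ∏ k, ‖p (a k)‖ :=
        (ContinuousLinearMap.le_opNorm _ _).trans (by gcongr; exact norm_pureTensor_le _)
    _ ≤ ‖dualOp (chainsMap j n) f‖ * ∏ k, (C * ‖a k‖) := by
        gcongr with k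
        exact hpn (a k)
    _ = C ^ (n + 1) * ‖dualOp (chainsMap j n) f‖ * ∏ k, ‖a k‖ := by
        rw [Finset.prod_mul_distrib, Finset.prod_const, Finset.card_univ, Fintype.card_fin]
        ring

variable {D : Type*} [NormedAddCommGroup D] [NormedSpace 𝕜 D]

theorem chainsMap_chainsMap_eq_zero (i : B →L[𝕜] A) (j : A →L[𝕜] D) (hij : ∀ x, j (i x) = 0)
    (n : ℕ) (x : Chains 𝕜 B n) : chainsMap j n (chainsMap i n x) = 0 := by
  have : chainsMap j n ∘L chainsMap i n = 0 := chains_ext fun b => by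
    rw [ContinuousLinearMap.comp_apply, chainsMap_pureTensor, chainsMap_pureTensor, pureTensor,
      MultilinearMap.map_coord_zero _ 0 (hij (b 0)), UniformSpace.Completion.coe_zero]
    rfl
  exact DFunLike.congr_fun this x

end TensorPowers

end BanachHomology

theorem theorem3p5 {𝕜 : Type*} [RCLike 𝕜]
    {B : Type*} [NonUnitalNormedRing B] [NormedSpace 𝕜 B] [IsScalarTower 𝕜 B B]
    [SMulCommClass 𝕜 B B] [CompleteSpace B]
    {A : Type*} [NonUnitalNormedRing A] [NormedSpace 𝕜 A] [IsScalarTower 𝕜 A A]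
    [SMulCommClass 𝕜 A A] [CompleteSpace A]
    {D : Type*} [NonUnitalNormedRing D] [NormedSpace 𝕜 D] [IsScalarTower 𝕜 D D]
    [SMulCommClass 𝕜 D D] [CompleteSpace D]
    (E : BanachHomology.BanachAlgebraExtension 𝕜 B A D) (hE : E.WeaklyAdmissible) :
    (E.HasSimplicialHomologySequence ↔ E.HasSimplicialCohomologySequence) ∧
      (E.HasBarHomologySequence ↔ E.HasBarCohomologySequence) := by
  -- Weak admissibility enters only through the right inverse `s` of the dual of `i`.
  obtain ⟨s, hs⟩ := hE.isAdmissible_dual.exists_rightInverse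
  have hi := BanachHomology.surjective_dualOp_chainsMap E.i s fun f => DFunLike.congr_fun hs f
  have hj := BanachHomology.surjective_chainsMap E.j E.isShortExact.surjective
  have hji := BanachHomology.chainsMap_chainsMap_eq_zero E.i E.j
    E.isShortExact.exact.apply_apply_eq_zero
  exact ⟨BanachHomology.hasLongExactHomology_iff_hasLongExactCohomology_dual _ _
      BanachHomology.simplicialD_simplicialD hi hj hji,
    BanachHomology.hasLongExactHomology_iff_hasLongExactCohomology_dual _ _
      BanachHomology.barD_barD hi hj hji⟩
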